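/- Let $\Lambda=2\mathbb Z\times2\mathbb Z\times\mathbb Z\subset\mathbb R^3$, let $L_b$ denote the translation $x\mapsto x+b$ of $\mathbb R^3$, let $e_1,e_2,e_3$ be the standard basis, and let $$\tau=\begin{pmatrix}0&-1&0\\1&0&0\\0&0&1\end{pmatrix},\quad \chi_1=\mathrm{diag}(1,-1,-1),\quad \chi_2=\mathrm{diag}(-1,1,-1),\quad \chi_3=\mathrm{diag}(-1,-1,1).$$ Put $\rho_0=\mathrm{Id}$, $\rho_1=\chi_1\circ L_{e_1}$, $\rho_2=\chi_2$, $\rho_3=\chi_3\circ L_{-e_1}$. Let $\Gamma_1$ be the group of isometries of Euclidean space $\mathbb R^3$ generated by $\{L_\lambda:\lambda\in\Lambda\}$ and $\tau$, and $\Gamma_2$ the one generated by $\{L_\lambda:\lambda\in\Lambda\}$ and $\rho_1,\rho_2,\rho_3$. For a group $\Gamma$ of isometries acting properly discontinuously on $\mathbb R^3$, the isotropy group of a point $[x]$ of the orbifold $\Gamma\backslash\mathbb R^3$ is the isomorphism class of the stabilizer of $x$ in $\Gamma$, its order is called the isotropy order, $[x]$ is called singular if this group is nontrivial, and the Laplace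 operator on functions on $\Gamma\backslash\mathbb R^3$ is the restriction of the Euclidean Laplacian $-(\partial_1^2+\partial_2^2+\partial_3^2)$ to the $\Gamma$-invariant smooth functions on $\mathbb R^3$. Then the following hold. 1. $\Gamma_1=\{\tau^jL_\lambda: j\in\{0,1,2,3\},\ \lambda\in\Lambda\}$ and $\Gamma_2=\{\rho_jL_\lambda: j\in\{0,1,2,3\},\ \lambda\in\Lambda\}$. 2. Both groups act properly discontinuously with compact quotient, so that $\mathcal O_1=\Gamma_1\backslash\mathbb R^3$ and $\mathcal O_2=\Gamma_2\backslash\mathbb R^3$ are compact flat orbifolds. The unit cube $[0,1]^3$ is a fundamental domain for both groups: its translates cover $\mathbb R^3$, and the translates of its interior are pairwise disjoint. 3. $\mathcal O_1$ and $\mathcal O_2$ are isospectral on functions: every number is an eigenvalue of the two Laplace operators with the same finite multiplicity (possibly zero). 4. The maximal isotropy order of $\mathcal O_1$ is $4$, and all isotropy groups of order $4$ in $\mathcal O_1$ are isomorphic to $\mathbb Z_4$. The maximal isotropy order of $\mathcal O_2$ is $2$, so all its singular points have isotropy group $\mathbb Z_2$. In particular, the maximal isotropy orders of the isospectral orbifolds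 $\mathcal O_1$ and $\mathcal O_2$ are different. 5. The singular set of $\mathcal O_1$ is the disjoint union of three circles of length one, the images of the lines in direction $e_3$ through $(0,0,0)$, $(1,1,0)$ and $(0,1,0)$; the points on the first two have isotropy group $\mathbb Z_4$, and those on the third $\mathbb Z_2$. 6. The singular set of $\mathcal O_2$ is the disjoint union of four circles: two of length two, the images of the lines in direction $e_2$ through $(0,0,0)$ and $(0,0,\frac12)$, and two of length one, the images of the lines in direction $e_3$ through $(\frac12,0,0)$ and $(\frac12,1,0)$. -/

import Mathlib

open scoped ContDiff Laplacian

noncomputable section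

namespace FlatOrbifold

/-- Euclidean three-space. -/
abbrev E : Type := EuclideanSpace ℝ (Fin 3)

/-- The isometry group of Euclidean three-space acts on it by evaluation; subgroups act by
restriction. -/
instance isometryAction : MulAction (E ≃ᵢ E) E where
  smul g x := g x
  one_smul _ := rfl
  mul_smul _ _ _ := rfl

@[simp] theorem isometry_smul_def (g : E ≃ᵢ E) (x : E) : g • x = g x := rfl

/-- The translation `x ↦ x + b`. -/
def transl (b : E) : E ≃ᵢ E := IsometryEquiv.addRight b

@[simp] theorem transl_apply (b x : E) : transl b x = x + b := rfl

/-- The linear isometry `x ↦ B x` given by an orthogonal matrix `B`. -/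
def ofOrthogonal (B : Matrix (Fin 3) (Fin 3) ℝ)
    (hB : B ∈ Matrix.orthogonalGroup (Fin 3) ℝ) : E ≃ᵢ E :=
  (Unitary.linearIsometryEquiv
    (⟨Matrix.toEuclideanCLM (n := Fin 3) (𝕜 := ℝ) B,
      Unitary.map_mem (Matrix.toEuclideanCLM (n := Fin 3) (𝕜 := ℝ)) hB⟩ :
        unitary (E →L[ℝ] E))).toIsometryEquiv

@[simp] theorem ofOrthogonal_apply (B : Matrix (Fin 3) (Fin 3) ℝ)
    (hB : B ∈ Matrix.orthogonalGroup (Fin 3) ℝ) (x : E) :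
    ofOrthogonal B hB x = WithLp.toLp 2 (B.mulVec (WithLp.ofLp x)) := rfl

/-! ### Orbifolds `Γ \ ℝ³` -/

/-- The underlying space of the orbifold `Γ \ ℝ³`, with the quotient topology. -/
abbrev Orbifold (Γ : Subgroup (E ≃ᵢ E)) : Type := MulAction.orbitRel.Quotient Γ E

/-- The canonical projection `ℝ³ → Γ \ ℝ³`. -/
def proj (Γ : Subgroup (E ≃ᵢ E)) (x : E) : Orbifold Γ := Quotient.mk _ x

/-- `Γ \ ℝ³` is a compact (good, flat) Riemannian orbifold: the group of isometries `Γ` acts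
properly discontinuously on `ℝ³` with compact quotient. The action is effective since `Γ` is
a group of isometries. -/
def IsCompactFlatOrbifold (Γ : Subgroup (E ≃ᵢ E)) : Prop :=
  ProperlyDiscontinuousSMul Γ E ∧ CompactSpace (Orbifold Γ)

/-- The stabilizer of `x` in `Γ`. -/
abbrev stab (Γ : Subgroup (E ≃ᵢ E)) (x : E) : Subgroup Γ := MulAction.stabilizer Γ x

/-- The isotropy group of the point `q` of `Γ \ ℝ³` is (isomorphic to) `G`: this is the
isomorphism class of the stabilizer of any point over `q`. -/
def HasIsotropy (Γ : Subgroup (E ≃ᵢ E)) (q : Orbifold Γ) (G : Type) [Group G] : Prop :=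
  ∀ x : E, proj Γ x = q → Nonempty (stab Γ x ≃* G)

/-- The cyclic group of order `n`, written multiplicatively. -/
abbrev Cyc (n : ℕ) : Type := Multiplicative (ZMod n)

/-- The set of singular points of `Γ \ ℝ³`: the points with nontrivial isotropy. -/
def singularSet (Γ : Subgroup (E ≃ᵢ E)) : Set (Orbifold Γ) :=
  {q | ∃ x : E, proj Γ x = q ∧ stab Γ x ≠ ⊥}

/-- All isotropy groups of `Γ \ ℝ³` are finite, and `n` is the largest of their orders. -/
def IsMaxIsotropyOrder (Γ : Subgroup (E ≃ᵢ E)) (n : ℕ) : Prop :=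
  (∀ x : E, Finite (stab Γ x)) ∧ IsGreatest {m : ℕ | ∃ x : E, Nat.card (stab Γ x) = m} n

/-- The eigenspace, for the eigenvalue `l`, of the Laplace operator `-(∂₁² + ∂₂² + ∂₃²)` on the
space of smooth complex valued functions on `Γ \ ℝ³`, that is, of `Γ`-invariant smooth
functions on `ℝ³`. -/
def eigenspace (Γ : Subgroup (E ≃ᵢ E)) (l : ℂ) : Submodule ℂ (E → ℂ) where
  carrier := {f | ContDiff ℝ ∞ f ∧ (∀ γ ∈ Γ, ∀ x, f (γ x) = f x) ∧ ∀ x, -(Δ f) x = l * f x}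
  zero_mem' := by
    refine ⟨contDiff_const, fun _ _ _ => rfl, fun x => ?_⟩
    have h : Δ (0 : E → ℂ) = 0 := InnerProductSpace.laplacian_const (c := (0 : ℂ))
    simp [h]
  add_mem' := by
    rintro f g ⟨hf, hf', hf''⟩ ⟨hg, hg', hg''⟩
    refine ⟨hf.add hg, fun γ hγ x => by simp [hf' γ hγ x, hg' γ hγ x], fun x => ?_⟩
    have h2 : (2 : WithTop ℕ∞) ≤ ∞ := WithTop.coe_le_coe.2 le_top
    rw [(hf.contDiffAt.of_le h2).laplacian_add (hg.contDiffAt.of_le h2), Pi.add_apply, mul_add,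
      ← hf'' x, ← hg'' x, neg_add]
  smul_mem' := by
    rintro c f ⟨hf, hf', hf''⟩
    refine ⟨contDiff_const.smul hf, fun γ hγ x => by simp [hf' γ hγ x], fun x => ?_⟩
    have h2 : (2 : WithTop ℕ∞) ≤ ∞ := WithTop.coe_le_coe.2 le_top
    rw [InnerProductSpace.laplacian_smul c (hf.contDiffAt.of_le h2), Pi.smul_apply, smul_eq_mul,
      smul_eq_mul, mul_left_comm, ← hf'' x, mul_neg]

/-- `Γ \ ℝ³` and `Γ' \ ℝ³` are isospectral on functions: every number is an eigenvalue of the two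
Laplace operators with the same finite multiplicity (possibly zero). -/
def Isospectral (Γ Γ' : Subgroup (E ≃ᵢ E)) : Prop :=
  ∀ l : ℂ, FiniteDimensional ℂ (eigenspace Γ l) ∧ FiniteDimensional ℂ (eigenspace Γ' l) ∧
    Module.finrank ℂ (eigenspace Γ l) = Module.finrank ℂ (eigenspace Γ' l)

/-- The set `D` is a fundamental domain for `Γ`: its translates cover `ℝ³`, and the translates of
its interior are pairwise disjoint. -/
def IsFundDomain (Γ : Subgroup (E ≃ᵢ E)) (D : Set E) : Prop :=
  (∀ x : E, ∃ γ ∈ Γ, γ x ∈ D) ∧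
    ∀ γ ∈ Γ, γ ≠ 1 → Disjoint (γ '' interior D) (interior D)

/-- The image in `Γ \ ℝ³` of the line `{p + t u | t ∈ ℝ}`. -/
def lineImage (Γ : Subgroup (E ≃ᵢ E)) (p u : E) : Set (Orbifold Γ) :=
  Set.range fun t : ℝ => proj Γ (p + t • u)

/-- The image in `Γ \ ℝ³` of the line `{p + t u | t ∈ ℝ}`, where `u` is a unit vector, is a circle
of length `L`: the unit speed curve `t ↦ [p + t u]` induces an injection of `ℝ / L ℤ`. -/
def IsCircleOfLength (Γ : Subgroup (E ≃ᵢ E)) (p u : E) (L : ℝ) : Prop :=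
  0 < L ∧ ‖u‖ = 1 ∧
    ∀ s t : ℝ, proj Γ (p + s • u) = proj Γ (p + t • u) ↔ ∃ n : ℤ, s - t = n * L

/-! ### The two groups -/

/-- The lattice `2ℤ × 2ℤ × ℤ`. -/
def lattice : Set E := {v | ∃ a b c : ℤ, v = !₂[2 * (a : ℝ), 2 * (b : ℝ), (c : ℝ)]}

/-- The standard basis vectors. -/
def e₁ : E := !₂[1, 0, 0]
def e₂ : E := !₂[0, 1, 0]
def e₃ : E := !₂[0, 0, 1]

/-- The quarter rotation around the third axis. -/
def τ : E ≃ᵢ E := ofOrthogonal !![0, -1, 0; 1, 0, 0; 0, 0, 1] (by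
  rw [Matrix.mem_orthogonalGroup_iff]
  ext i j; fin_cases i <;> fin_cases j <;> simp [Matrix.mul_apply, Fin.sum_univ_three])

/-- The half-turn around the first axis. -/
def χ₁ : E ≃ᵢ E := ofOrthogonal !![1, 0, 0; 0, -1, 0; 0, 0, -1] (by
  rw [Matrix.mem_orthogonalGroup_iff]
  ext i j; fin_cases i <;> fin_cases j <;> simp [Matrix.mul_apply, Fin.sum_univ_three])

/-- The half-turn around the second axis. -/
def χ₂ : E ≃ᵢ E := ofOrthogonal !![-1, 0, 0; 0, 1, 0; 0, 0, -1] (by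
  rw [Matrix.mem_orthogonalGroup_iff]
  ext i j; fin_cases i <;> fin_cases j <;> simp [Matrix.mul_apply, Fin.sum_univ_three])

/-- The half-turn around the third axis. -/
def χ₃ : E ≃ᵢ E := ofOrthogonal !![-1, 0, 0; 0, -1, 0; 0, 0, 1] (by
  rw [Matrix.mem_orthogonalGroup_iff]
  ext i j; fin_cases i <;> fin_cases j <;> simp [Matrix.mul_apply, Fin.sum_univ_three])

/-- `ρ 0 = Id`, and `ρ j` is the composition of the half-turn `χⱼ` after the translation by `bⱼ`,
where `b₁ = e₁`, `b₂ = 0`, `b₃ = -e₁`. -/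
def ρ : Fin 4 → E ≃ᵢ E :=
  ![1, χ₁ * transl e₁, χ₂ * transl 0, χ₃ * transl (-e₁)]

/-- The group generated by the lattice translations and the quarter rotation `τ`. -/
def Γ₁ : Subgroup (E ≃ᵢ E) := Subgroup.closure (transl '' lattice ∪ {τ})

/-- The group generated by the lattice translations and `ρ 1`, `ρ 2`, `ρ 3`. -/
def Γ₂ : Subgroup (E ≃ᵢ E) := Subgroup.closure (transl '' lattice ∪ {ρ 1, ρ 2, ρ 3})

/-- The unit cube `[0,1]³`. -/
def unitCube : Set E := {x | ∀ i, x i ∈ Set.Icc (0 : ℝ) 1}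

/-- Points on the three singular axes (in direction `e₃`) of `Γ₁`. -/
def axisPoint₁ : Fin 3 → E := ![0, !₂[1, 1, 0], !₂[0, 1, 0]]

/-- Points on the four singular axes of `Γ₂`. -/
def axisPoint₂ : Fin 4 → E := ![0, !₂[0, 0, 1/2], !₂[1/2, 0, 0], !₂[1/2, 1, 0]]

/-- Directions of the four singular axes of `Γ₂`. -/
def axisDir₂ : Fin 4 → E := ![e₂, e₂, e₃, e₃]

end FlatOrbifold

end

/-!
The two groups are extensions of the lattice `Λ = 2ℤ × 2ℤ × ℤ` by the four isometries `τ ^ j` and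
`ρ j`, respectively: these normalize the translations and multiply, modulo `Λ`, like the cyclic and
the Klein group of order four (`isCosetSystem_rot`, `isCosetSystem_ρ`). Hence every element has one
of four explicit coordinate formulas (`mem_Γ₁`, `mem_Γ₂`). All statements on fundamental domains,
stabilizers and circles follow from these formulas, because an isometry of the group that fixes a
point or relates two points imposes linear equations with integral unknowns on the coordinates. For
instance, `ρ 1` shifts the first coordinate by an odd integer and so has no fixed point modulo `Λ`,
whereas `ρ 2`, `ρ 3` reflect the first coordinate in points of `ℤ` and of `ℤ + 1 / 2`; thus no point
is fixed by elements of two nontrivial cosets, and isotropy groups of `Γ₂` have order at most two.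

For isospectrality, let `f` be a smooth `Λ`-periodic function with `-Δ f = l f`. It descends to the
torus, where differentiation multiplies Fourier coefficients by the symbol of the derivative
(`mFourierCoeff_deriv`), so only the finitely many frequencies with eigenvalue `l` occur and `f` is
a linear combination of the corresponding plane waves (`exists_eq_sum_wave`). Those are linearly
independent. On their span the averaging operator `f ↦ ¼ ∑ⱼ f ∘ gⱼ` over coset representatives
is a projection onto the eigenspace of the group, whose dimension is therefore the trace
`¼ ∑ⱼ ∑ₙ [σⱼ n = n] sⱼ(n)`, where `gⱼ` maps the wave `n` to `sⱼ(n)` times the wave `σⱼ n`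
(`finrank_eigenspace`). The identity contributes equally for both groups. For `Γ₁`, the three
nontrivial rotations each contribute the number `N` of frequencies on the third axis. For `Γ₂`, the
half-turn `ρ 3` contributes `N`, and `ρ 1` and `ρ 2` together contribute `2 N`: on the first axis the
translational part of `ρ 1` produces the sign `(-1) ^ n 0`, so that odd frequencies cancel against
those on the second axis, while the even ones on both axes correspond to those on the third
(`sum_axes`).
-/

noncomputable section

namespace FlatOrbifold

open MeasureTheory UnitAddTorus Filter Topology

/-! ### Fourier coefficients on the torus -/

-- The normalized Haar measure on the circle, with respect to which `mFourierCoeff` is defined.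
local instance : MeasureSpace UnitAddCircle := ⟨AddCircle.haarAddCircle⟩

local instance : Measure.IsAddHaarMeasure (volume : Measure UnitAddCircle) :=
  inferInstanceAs (Measure.IsAddHaarMeasure AddCircle.haarAddCircle)

local instance : IsProbabilityMeasure (volume : Measure UnitAddCircle) :=
  inferInstanceAs (IsProbabilityMeasure AddCircle.haarAddCircle)

/-- Translating a function multiplies its Fourier coefficients by the values of the characters. -/
theorem mFourierCoeff_translate {d : Type*} [Fintype d] (F : C(UnitAddTorus d, ℂ)) (n : d → ℤ)
    (a : UnitAddTorus d) :
    mFourierCoeff (fun t => F (t + a)) n = mFourier n a * mFourierCoeff F n := by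
  have h1 : ∀ t, mFourier (-n) t • F (t + a) =
      mFourier n a * (mFourier (-n) (t + a) • F (t + a)) := by
    intro t
    have h : mFourier (-n) (t + a) = mFourier (-n) t * mFourier (-n) a := by
      simp [mFourier, Finset.prod_mul_distrib, smul_add, AddCircle.toCircle_add]
    have h' : mFourier n a * mFourier (-n) a = 1 := by
      rw [← mFourier_add, add_neg_cancel, mFourier_zero]; rfl
    rw [h, smul_eq_mul, smul_eq_mul]
    linear_combination -(mFourier (-n) t * F (t + a)) * h'
  unfold mFourierCoeff
  rw [← integral_const_mul, integral_congr_ae (Eventually.of_forall h1)]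
  exact integral_add_right_eq_self
    (fun t => mFourier n a * (mFourier (-n) t • F t)) a

/-- Differentiation along a one-parameter subgroup `u` of the torus multiplies the `n`-th Fourier
coefficient by the derivative at `0` of the `n`-th character along `u`. This takes the place of an
integration by parts: the coefficient of the translate by `u h` is differentiated at `h = 0`. -/
theorem mFourierCoeff_deriv {d : Type*} [Fintype d] (F F' : C(UnitAddTorus d, ℂ)) (n : d → ℤ)
    (u : C(ℝ, UnitAddTorus d)) (hu0 : u 0 = 0)
    (hF : ∀ t h, HasDerivAt (fun h => F (t + u h)) (F' (t + u h)) h) {k : ℂ}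
    (hk : HasDerivAt (fun h => mFourier n (u h)) k 0) :
    mFourierCoeff F' n = k * mFourierCoeff F n := by
  have h1 : HasDerivAt (fun h => mFourierCoeff (fun t => F (t + u h)) n)
      (∫ t, mFourier (-n) t • F' (t + u 0)) 0 := by
    refine (hasDerivAt_integral_of_dominated_loc_of_deriv_le (bound := fun _ => ‖F'‖)
      (F' := fun h t => mFourier (-n) t • F' (t + u h)) (s := Set.univ) univ_mem ?_ ?_ ?_ ?_ ?_
      ?_).2
    · exact Eventually.of_forall fun h => Continuous.aestronglyMeasurable (by fun_prop)
    · exact Continuous.integrable_of_hasCompactSupport (by fun_prop)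
        (HasCompactSupport.of_compactSpace _)
    · exact Continuous.aestronglyMeasurable (by fun_prop)
    · refine Eventually.of_forall fun t h _ => ?_
      calc ‖mFourier (-n) t • F' (t + u h)‖ ≤ ‖mFourier (-n) t‖ * ‖F' (t + u h)‖ := norm_smul_le _ _
        _ ≤ ‖mFourier (-n)‖ * ‖F'‖ := by
          gcongr
          · exact ContinuousMap.norm_coe_le_norm _ _
          · exact ContinuousMap.norm_coe_le_norm _ _
        _ = ‖F'‖ := by rw [mFourier_norm, one_mul]
    · exact integrable_const _
    · exact Eventually.of_forall fun t h _ => (hF t h).const_smul (mFourier (-n) t)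
  have h2 : HasDerivAt (fun h => mFourierCoeff (fun t => F (t + u h)) n)
      (k * mFourierCoeff F n) 0 := by
    simp only [mFourierCoeff_translate]
    exact hk.mul_const _
  have h3 := h1.unique h2
  simpa [hu0, mFourierCoeff] using h3

/-! ### The torus of the lattice and its plane waves -/

/-- The periods of `lattice` in the three coordinates. -/
def period : Fin 3 → ℝ := ![2, 2, 1]

theorem period_ne_zero (i : Fin 3) : period i ≠ 0 := by
  fin_cases i <;> simp [period]

/-- The covering of the torus `ℝ³ / ℤ³` by `ℝ³` whose group of deck transformations is
`lattice`. -/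
def toTorus (x : E) : UnitAddTorus (Fin 3) := fun i => ((x i / period i : ℝ) : UnitAddCircle)

theorem toTorus_add (x y : E) : toTorus (x + y) = toTorus x + toTorus y := by
  ext i; simp [toTorus, add_div]

theorem isOpenQuotientMap_toTorus : IsOpenQuotientMap toTorus := by
  have h1 : IsOpenQuotientMap (Pi.map fun (_ : Fin 3) (y : ℝ) => (y : UnitAddCircle)) :=
    IsOpenQuotientMap.piMap fun _ => QuotientAddGroup.isOpenQuotientMap_mk
  let e : E ≃ₜ (Fin 3 → ℝ) := (PiLp.homeomorph 2 _).trans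
    (Homeomorph.piCongrRight fun i => Homeomorph.mulRight₀ _ (inv_ne_zero (period_ne_zero i)))
  have h2 := h1.comp e.isOpenQuotientMap
  exact h2

theorem sub_mem_lattice_of_toTorus_eq {x y : E} (h : toTorus x = toTorus y) :
    x - y ∈ lattice := by
  have h' : ∀ i, ∃ n : ℤ, x i / period i - y i / period i = n := by
    intro i
    have := congrFun h i
    simp only [toTorus] at this
    rw [← sub_eq_zero, ← AddCircle.coe_sub, AddCircle.coe_eq_zero_iff] at this
    obtain ⟨n, hn⟩ := this
    exact ⟨n, by simpa using hn.symm⟩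
  obtain ⟨a, ha⟩ := h' 0
  obtain ⟨b, hb⟩ := h' 1
  obtain ⟨c, hc⟩ := h' 2
  refine ⟨a, b, c, ?_⟩
  simp only [period, Matrix.cons_val] at ha hb hc
  ext i
  fin_cases i <;> simp <;> linarith

/-- A continuous `lattice`-periodic function descends to the torus. -/
theorem exists_lift_torus {f : E → ℂ} (hf : Continuous f)
    (hper : ∀ v ∈ lattice, ∀ x, f (x + v) = f x) :
    ∃ F : C(UnitAddTorus (Fin 3), ℂ), ∀ x, F (toTorus x) = f x := by
  have key : Function.FactorsThrough f toTorus := by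
    intro x y hxy
    have := hper _ (sub_mem_lattice_of_toTorus_eq hxy) y
    rwa [add_sub_cancel] at this
  refine ⟨isOpenQuotientMap_toTorus.isQuotientMap.lift (f := ⟨toTorus,
    isOpenQuotientMap_toTorus.continuous⟩) ⟨f, hf⟩ key, fun x => ?_⟩
  exact congrFun (congrArg DFunLike.coe (Topology.IsQuotientMap.lift_comp
    (f := ⟨toTorus, isOpenQuotientMap_toTorus.continuous⟩)
    isOpenQuotientMap_toTorus.isQuotientMap ⟨f, hf⟩ key)) x

/-- The real phase of the plane wave with frequency `n` in the lattice dual to `lattice`. -/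
def phase (n : Fin 3 → ℤ) : E →L[ℝ] ℝ :=
  (n 0 / 2 : ℝ) • EuclideanSpace.proj 0 + (n 1 / 2 : ℝ) • EuclideanSpace.proj 1 +
    (n 2 : ℝ) • EuclideanSpace.proj 2

theorem phase_apply (n : Fin 3 → ℤ) (x : E) :
    phase n x = n 0 / 2 * x 0 + n 1 / 2 * x 1 + n 2 * x 2 := by
  simp [phase]

/-- The plane wave `x ↦ exp (2 π i ⟨n, x⟩)`, where the integral vector `n` lists the coordinates of
a vector of the lattice dual to `lattice`. -/
def wave (n : Fin 3 → ℤ) (x : E) : ℂ := Complex.exp (2 * Real.pi * Complex.I * phase n x)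

theorem wave_add (n : Fin 3 → ℤ) (x y : E) : wave n (x + y) = wave n x * wave n y := by
  simp only [wave, map_add, Complex.ofReal_add, mul_add, Complex.exp_add]

theorem mFourier_toTorus (n : Fin 3 → ℤ) (x : E) : mFourier n (toTorus x) = wave n x := by
  simp only [mFourier, toTorus, ContinuousMap.coe_mk, fourier_coe_apply, wave,
    Fin.prod_univ_three, ← Complex.exp_add, phase_apply, period, Matrix.cons_val]
  congr 1
  push_cast
  ring

/-- The standard basis vector in direction `i`. -/
abbrev dir (i : Fin 3) : E := EuclideanSpace.single i 1

/-- The partial derivative of `f` in direction `i`. -/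
def partialD (i : Fin 3) (f : E → ℂ) (x : E) : ℂ := fderiv ℝ f x (dir i)

theorem contDiff_partialD {f : E → ℂ} (hf : ContDiff ℝ ∞ f) (i : Fin 3) :
    ContDiff ℝ ∞ (partialD i f) := by
  have := hf.fderiv_right (m := ∞) (by simp)
  exact this.clm_apply contDiff_const

theorem partialD_periodic {f : E → ℂ} {v : E} (hper : ∀ x, f (x + v) = f x) (i : Fin 3) (x : E) :
    partialD i f (x + v) = partialD i f x := by
  have : (fun y => f (y + v)) = f := funext hper
  unfold partialD
  rw [← fderiv_comp_add_right, this]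

theorem laplacian_eq_sum_partialD {f : E → ℂ} (hf : ContDiff ℝ ∞ f) (x : E) :
    (Δ f) x = ∑ i, partialD i (partialD i f) x := by
  rw [InnerProductSpace.laplacian_eq_iteratedFDeriv_orthonormalBasis f
    (EuclideanSpace.basisFun (Fin 3) ℝ)]
  refine Finset.sum_congr rfl fun i _ => ?_
  have hd : DifferentiableAt ℝ (fderiv ℝ f) x :=
    ((hf.fderiv_right (m := ∞) (by simp)).differentiable (by simp)).differentiableAt
  rw [iteratedFDeriv_two_apply]
  unfold partialD
  rw [fderiv_clm_apply hd (differentiableAt_const _)]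
  simp

theorem hasDerivAt_line {f : E → ℂ} (hf : ContDiff ℝ ∞ f) (i : Fin 3) (x : E) (h : ℝ) :
    HasDerivAt (fun h : ℝ => f (x + h • dir i)) (partialD i f (x + h • dir i)) h := by
  have h1 : HasDerivAt (fun h : ℝ => x + h • dir i) (dir i) h := by
    simpa using ((hasDerivAt_id h).smul_const (dir i)).const_add x
  exact ((hf.differentiable (by simp)).differentiableAt.hasFDerivAt).comp_hasDerivAt h h1

theorem contDiff_wave (n : Fin 3 → ℤ) : ContDiff ℝ ∞ (wave n) := by
  unfold wave
  have : ContDiff ℝ ∞ fun x => (phase n x : ℂ) :=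
    Complex.ofRealCLM.contDiff.comp (phase n).contDiff
  fun_prop

theorem partialD_wave (n : Fin 3 → ℤ) (i : Fin 3) (x : E) :
    partialD i (wave n) x = 2 * Real.pi * Complex.I * (n i / period i) * wave n x := by
  have h0 := hasDerivAt_line (contDiff_wave n) i x 0
  have h1 : HasDerivAt (fun h : ℝ => wave n (x + h • dir i))
      (wave n x * (2 * Real.pi * Complex.I * (n i / period i))) 0 := by
    have e : (fun h : ℝ => wave n (x + h • dir i)) = fun h : ℝ =>
        wave n x * Complex.exp (h * (2 * Real.pi * Complex.I * (n i / period i))) := by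
      funext h
      rw [wave_add]
      congr 1
      unfold wave
      congr 1
      fin_cases i <;> simp [phase_apply, period] <;> ring
    rw [e]
    have := ((Complex.ofRealCLM.hasDerivAt (x := (0 : ℝ))).mul_const
      (2 * Real.pi * Complex.I * (n i / period i))).cexp.const_mul (wave n x)
    simpa using this
  rw [zero_smul, add_zero] at h0
  rw [h0.unique h1, mul_comm]

/-- The eigenvalue `4 π² ‖n‖²` of the plane wave with frequency `n`. -/
def energy (n : Fin 3 → ℤ) : ℝ := Real.pi ^ 2 * (n 0 ^ 2 + n 1 ^ 2 + 4 * n 2 ^ 2)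

theorem sum_sq_symbol (n : Fin 3 → ℤ) :
    ∑ i, (2 * Real.pi * Complex.I * (n i / period i)) ^ 2 = -(energy n : ℂ) := by
  simp only [Fin.sum_univ_three, energy, period, Matrix.cons_val]
  push_cast
  linear_combination (Real.pi : ℂ) ^ 2 * ((n 0 : ℂ) ^ 2 + (n 1 : ℂ) ^ 2 + 4 * (n 2 : ℂ) ^ 2) *
    Complex.I_sq

theorem laplacian_wave (n : Fin 3 → ℤ) (x : E) :
    (Δ (wave n)) x = -(energy n : ℂ) * wave n x := by
  rw [laplacian_eq_sum_partialD (contDiff_wave n), ← sum_sq_symbol, Finset.sum_mul]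
  refine Finset.sum_congr rfl fun i _ => ?_
  have h : partialD i (wave n) = fun x => (2 * Real.pi * Complex.I * (n i / period i)) * wave n x :=
    funext fun x => partialD_wave n i x
  have h' : partialD i (partialD i (wave n)) x =
      (2 * Real.pi * Complex.I * (n i / period i)) * partialD i (wave n) x := by
    conv_lhs => rw [h]
    unfold partialD
    rw [fderiv_const_mul ((contDiff_wave n).differentiable (by simp)).differentiableAt]
    rfl
  rw [h', partialD_wave]
  ring

/-- The finitely many frequencies with eigenvalue `l`. -/
def shell (l : ℂ) : Set (Fin 3 → ℤ) := {n | (energy n : ℂ) = l}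

theorem finite_shell (l : ℂ) : (shell l).Finite := by
  obtain ⟨N, hN⟩ := exists_nat_ge (l.re / Real.pi ^ 2)
  refine (Set.finite_Icc (fun _ : Fin 3 => -(N : ℤ)) (fun _ => (N : ℤ))).subset ?_
  intro n hn
  have h1 : energy n = l.re := by rw [← hn]; simp
  have h2 : (n 0 : ℝ) ^ 2 + n 1 ^ 2 + 4 * n 2 ^ 2 ≤ N := by
    rw [← h1, energy, mul_div_cancel_left₀ _ (by positivity)] at hN
    exact hN
  have h3 : n 0 ^ 2 + n 1 ^ 2 + 4 * n 2 ^ 2 ≤ (N : ℤ) := by exact_mod_cast h2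
  have h4 : ∀ i, n i ^ 2 ≤ (N : ℤ) := by
    intro i
    have := sq_nonneg (n 0)
    have := sq_nonneg (n 1)
    have := sq_nonneg (n 2)
    fin_cases i <;> simp <;> linarith
  have h5 : ∀ i, |n i| ≤ (N : ℤ) := fun i => by
    have := h4 i
    by_contra! hc
    have h6 : (N : ℤ) * 1 ≤ N * |n i| := by
      apply mul_le_mul_of_nonneg_left <;> omega
    have := sq_abs (n i)
    nlinarith
  exact ⟨fun i => (abs_le.1 (h5 i)).1, fun i => (abs_le.1 (h5 i)).2⟩

instance (l : ℂ) : Fintype (shell l) := (finite_shell l).fintype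

theorem mFourierCoeff_partialD {f : E → ℂ} (hf : ContDiff ℝ ∞ f) (i : Fin 3)
    {F F' : C(UnitAddTorus (Fin 3), ℂ)} (hF : ∀ x, F (toTorus x) = f x)
    (hF' : ∀ x, F' (toTorus x) = partialD i f x) (n : Fin 3 → ℤ) :
    mFourierCoeff F' n = 2 * Real.pi * Complex.I * (n i / period i) * mFourierCoeff F n := by
  refine mFourierCoeff_deriv F F' n ⟨fun h => toTorus (h • dir i),
    isOpenQuotientMap_toTorus.continuous.comp (by fun_prop)⟩ ?_ ?_ ?_
  · ext j; simp [toTorus]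
  · intro t h
    obtain ⟨x, rfl⟩ := isOpenQuotientMap_toTorus.surjective t
    simp only [ContinuousMap.coe_mk, ← toTorus_add, hF, hF']
    exact hasDerivAt_line hf i x h
  · have h := hasDerivAt_line (contDiff_wave n) i 0 0
    have h0 : wave n 0 = 1 := by simp [wave]
    simpa [mFourier_toTorus, partialD_wave, h0] using h

/-- A smooth `lattice`-periodic eigenfunction of the Laplace operator is a linear combination of the
finitely many plane waves with the same eigenvalue. -/
theorem exists_eq_sum_wave {f : E → ℂ} {l : ℂ} (hf : ContDiff ℝ ∞ f)
    (hper : ∀ v ∈ lattice, ∀ x, f (x + v) = f x) (hl : ∀ x, -(Δ f) x = l * f x) :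
    ∃ c : shell l → ℂ, f = ∑ n, c n • wave n := by
  obtain ⟨F, hF⟩ := exists_lift_torus hf.continuous hper
  have hD := fun i => exists_lift_torus (contDiff_partialD hf i).continuous
    fun v hv => partialD_periodic (hper v hv) i
  choose F1 hF1 using hD
  have hD2 := fun i => exists_lift_torus (contDiff_partialD (contDiff_partialD hf i) i).continuous
    fun v hv => partialD_periodic (partialD_periodic (hper v hv) i) i
  choose F2 hF2 using hD2
  have hlap : ∑ i, F2 i = (-l) • F := by
    ext t
    obtain ⟨x, rfl⟩ := isOpenQuotientMap_toTorus.surjective t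
    simp only [ContinuousMap.coe_sum, Finset.sum_apply, hF2, ContinuousMap.smul_apply, hF]
    rw [← laplacian_eq_sum_partialD hf, smul_eq_mul, neg_mul, ← hl, neg_neg]
  have hcoeff : ∀ n, ∑ i, mFourierCoeff (F2 i) n = -l * mFourierCoeff F n := by
    intro n
    have h := congrArg (fun G : C(UnitAddTorus (Fin 3), ℂ) => mFourierCoeff G n) hlap
    simp only [mFourierCoeff, ContinuousMap.coe_sum, Finset.sum_apply, Finset.mul_sum,
      ContinuousMap.smul_apply, smul_eq_mul] at h ⊢
    rw [integral_finsetSum] at h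
    · rw [h, ← integral_const_mul]
      congr 1
      funext t
      ring
    · intro i _
      exact Continuous.integrable_of_hasCompactSupport (by fun_prop)
        (HasCompactSupport.of_compactSpace _)
  have hzero : ∀ n, n ∉ shell l → mFourierCoeff F n = 0 := by
    intro n hn
    have h := hcoeff n
    simp only [mFourierCoeff_partialD (contDiff_partialD hf _) _ (hF1 _) (hF2 _),
      mFourierCoeff_partialD hf _ hF (hF1 _), ← mul_assoc, ← sq] at h
    rw [← Finset.sum_mul, sum_sq_symbol] at h
    have h2 : ((energy n : ℂ) - l) * mFourierCoeff F n = 0 := by linear_combination -h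
    exact (mul_eq_zero.1 h2).resolve_left (sub_ne_zero.2 hn)
  have hsum : Summable (mFourierCoeff F) :=
    summable_of_ne_finset_zero (s := (finite_shell l).toFinset) fun n hn => hzero n (by simpa using hn)
  refine ⟨fun n => mFourierCoeff F n, funext fun x => ?_⟩
  have h := hasSum_mFourier_series_apply_of_summable hsum (toTorus x)
  have h' : HasSum (fun n => mFourierCoeff F n • mFourier n (toTorus x))
      (∑ n ∈ (finite_shell l).toFinset, mFourierCoeff F n • mFourier n (toTorus x)) :=
    hasSum_sum_of_ne_finset_zero fun n hn => by rw [hzero n (by simpa using hn), zero_smul]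
  rw [← hF x, h.unique h', Finset.sum_apply]
  simp only [mFourier_toTorus, Pi.smul_apply]
  rw [← Finset.sum_coe_sort]
  refine Fintype.sum_equiv (Equiv.subtypeEquivRight fun n => by simp) _ _ fun n => rfl

end FlatOrbifold

end

noncomputable section

namespace FlatOrbifold

/-! ### The elements of the two groups -/

theorem zero_mem_lattice : (0 : E) ∈ lattice :=
  ⟨0, 0, 0, by ext i; fin_cases i <;> simp⟩

theorem add_mem_lattice {v w : E} (hv : v ∈ lattice) (hw : w ∈ lattice) : v + w ∈ lattice := by
  obtain ⟨a, b, c, rfl⟩ := hv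
  obtain ⟨a', b', c', rfl⟩ := hw
  exact ⟨a + a', b + b', c + c', by ext i; fin_cases i <;> simp <;> ring⟩

theorem neg_mem_lattice {v : E} (hv : v ∈ lattice) : -v ∈ lattice := by
  obtain ⟨a, b, c, rfl⟩ := hv
  exact ⟨-a, -b, -c, by ext i; fin_cases i <;> simp⟩

theorem transl_zero : transl 0 = 1 := by
  ext x : 1
  exact add_zero x

theorem transl_mul (v w : E) : transl v * transl w = transl (w + v) := by
  ext x : 1
  simp [IsometryEquiv.mul_apply, add_assoc]

theorem transl_inv (v : E) : (transl v)⁻¹ = transl (-v) := by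
  rw [inv_eq_iff_mul_eq_one, transl_mul, neg_add_cancel, transl_zero]

/-- The isometries `g 0, …, g 3` represent the cosets of a group containing the translations by
`lattice` as a normal subgroup; the multiplication of the cosets is given by `m`. -/
structure IsCosetSystem (g : Fin 4 → E ≃ᵢ E) (m : Fin 4 → Fin 4 → Fin 4) : Prop where
  zero : g 0 = 1
  bijective : ∀ k, Function.Bijective (m · k)
  transl_mul : ∀ j, ∀ v ∈ lattice, ∃ w ∈ lattice, transl v * g j = g j * transl w
  mul_transl : ∀ j, ∀ v ∈ lattice, ∃ w ∈ lattice, g j * transl v = transl w * g j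
  mul : ∀ j k, ∃ w ∈ lattice, g j * g k = g (m j k) * transl w

/-- The group whose cosets modulo `lattice` are represented by a coset system. -/
def IsCosetSystem.group {g : Fin 4 → E ≃ᵢ E} {m : Fin 4 → Fin 4 → Fin 4}
    (h : IsCosetSystem g m) : Subgroup (E ≃ᵢ E) where
  carrier := {γ | ∃ j : Fin 4, ∃ v ∈ lattice, γ = g j * transl v}
  one_mem' := ⟨0, 0, zero_mem_lattice, by rw [h.zero, transl_zero, one_mul]⟩
  mul_mem' := by
    rintro _ _ ⟨j, v, hv, rfl⟩ ⟨k, w, hw, rfl⟩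
    obtain ⟨v', hv', e⟩ := h.transl_mul k v hv
    obtain ⟨u, hu, e'⟩ := h.mul j k
    refine ⟨m j k, w + v' + u, add_mem_lattice (add_mem_lattice hw hv') hu, ?_⟩
    rw [mul_assoc, ← mul_assoc (transl v), e, ← FlatOrbifold.transl_mul u,
      ← FlatOrbifold.transl_mul v', ← mul_assoc (g (m j k)), ← e']
    simp only [mul_assoc]
  inv_mem' := by
    rintro _ ⟨j, v, hv, rfl⟩
    obtain ⟨k, hk⟩ := (h.bijective j).2 0
    obtain ⟨w, hw, e⟩ := h.mul k j
    simp only at hk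
    rw [hk, h.zero, one_mul] at e
    obtain ⟨u, hu, e'⟩ := h.transl_mul k _
      (add_mem_lattice (neg_mem_lattice hw) (neg_mem_lattice hv))
    refine ⟨k, u, hu, ?_⟩
    rw [← e', mul_inv_rev, transl_inv, ← FlatOrbifold.transl_mul, mul_assoc, ← transl_inv w, ← e]
    group

theorem IsCosetSystem.closure_eq {g : Fin 4 → E ≃ᵢ E} {m : Fin 4 → Fin 4 → Fin 4}
    (h : IsCosetSystem g m) {S : Set (E ≃ᵢ E)} (hS : S ⊆ Set.range g)
    (hg : ∀ j, g j ∈ Subgroup.closure (transl '' lattice ∪ S)) :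
    (Subgroup.closure (transl '' lattice ∪ S) : Set (E ≃ᵢ E)) =
      {γ | ∃ j : Fin 4, ∃ v ∈ lattice, γ = g j * transl v} := by
  apply Set.Subset.antisymm
  · have : Subgroup.closure (transl '' lattice ∪ S) ≤ h.group := by
      rw [Subgroup.closure_le]
      rintro γ (⟨v, hv, rfl⟩ | hγ)
      · exact ⟨0, v, hv, by rw [h.zero, one_mul]⟩
      · obtain ⟨j, rfl⟩ := hS hγ
        exact ⟨j, 0, zero_mem_lattice, by rw [transl_zero, mul_one]⟩
    exact this
  · rintro _ ⟨j, v, hv, rfl⟩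
    exact mul_mem (hg j) (Subgroup.subset_closure (Or.inl ⟨v, hv, rfl⟩))

theorem τ_apply (x : E) : τ x = !₂[-x 1, x 0, x 2] := by
  ext i; fin_cases i <;> simp [τ, dotProduct, Fin.sum_univ_three]

theorem τ_sq_apply (x : E) : (τ ^ 2) x = !₂[-x 0, -x 1, x 2] := by
  rw [pow_two, IsometryEquiv.mul_apply, τ_apply, τ_apply]; simp

theorem τ_cube_apply (x : E) : (τ ^ 3) x = !₂[x 1, -x 0, x 2] := by
  rw [pow_succ, IsometryEquiv.mul_apply, τ_apply, τ_sq_apply]; simp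

theorem τ_pow_four : τ ^ 4 = 1 := by
  ext x : 1
  rw [pow_succ, IsometryEquiv.mul_apply, τ_apply, τ_cube_apply]
  ext i; fin_cases i <;> simp

theorem ρ_zero : ρ 0 = 1 := rfl

theorem ρ_one_apply (x : E) : ρ 1 x = !₂[x 0 + 1, -x 1, -x 2] := by
  ext i; fin_cases i <;> simp [ρ, χ₁, e₁, Matrix.vecHead, Matrix.vecTail]

theorem ρ_two_apply (x : E) : ρ 2 x = !₂[-x 0, x 1, -x 2] := by
  ext i; fin_cases i <;> simp [ρ, χ₂, dotProduct, Fin.sum_univ_three]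

theorem ρ_three_apply (x : E) : ρ 3 x = !₂[-x 0 + 1, -x 1, x 2] := by
  ext i; fin_cases i <;> simp [ρ, χ₃, e₁, Matrix.vecHead, Matrix.vecTail]; ring

/-- The representatives `τ ^ j` of the cosets of `Γ₁`. -/
def rot (j : Fin 4) : E ≃ᵢ E := τ ^ (j : ℕ)

/-- The multiplication of the cosets of `Γ₂`, that is, of the Klein four-group on `Fin 4` with
neutral element `0`. -/
def kleinMul : Fin 4 → Fin 4 → Fin 4 :=
  ![![0, 1, 2, 3], ![1, 0, 3, 2], ![2, 3, 0, 1], ![3, 2, 1, 0]]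

theorem isCosetSystem_rot : IsCosetSystem rot (· + ·) where
  zero := pow_zero τ
  bijective := by decide
  transl_mul := by
    rintro j _ ⟨a, b, c, rfl⟩
    fin_cases j
    · exact ⟨_, ⟨a, b, c, rfl⟩, by simp [rot]⟩
    · refine ⟨_, ⟨b, -a, c, rfl⟩, ?_⟩
      ext x i
      fin_cases i <;> simp [rot, IsometryEquiv.mul_apply, τ_apply] <;> ring
    · refine ⟨_, ⟨-a, -b, c, rfl⟩, ?_⟩
      ext x i
      fin_cases i <;> simp [rot, IsometryEquiv.mul_apply, τ_sq_apply] <;> ring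
    · refine ⟨_, ⟨-b, a, c, rfl⟩, ?_⟩
      ext x i
      fin_cases i <;> simp [rot, IsometryEquiv.mul_apply, τ_cube_apply] <;> ring
  mul_transl := by
    rintro j _ ⟨a, b, c, rfl⟩
    fin_cases j
    · exact ⟨_, ⟨a, b, c, rfl⟩, by simp [rot]⟩
    · refine ⟨_, ⟨-b, a, c, rfl⟩, ?_⟩
      ext x i
      fin_cases i <;> simp [rot, IsometryEquiv.mul_apply, τ_apply] <;> ring
    · refine ⟨_, ⟨-a, -b, c, rfl⟩, ?_⟩
      ext x i
      fin_cases i <;> simp [rot, IsometryEquiv.mul_apply, τ_sq_apply] <;> ring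
    · refine ⟨_, ⟨b, -a, c, rfl⟩, ?_⟩
      ext x i
      fin_cases i <;> simp [rot, IsometryEquiv.mul_apply, τ_cube_apply] <;> ring
  mul := by
    intro j k
    refine ⟨0, zero_mem_lattice, ?_⟩
    rw [transl_zero, mul_one, rot, rot, rot, ← pow_add, Fin.val_add]
    exact pow_eq_pow_mod _ τ_pow_four

theorem isCosetSystem_ρ : IsCosetSystem ρ kleinMul where
  zero := rfl
  bijective := by decide
  transl_mul := by
    rintro j _ ⟨a, b, c, rfl⟩
    fin_cases j
    · exact ⟨_, ⟨a, b, c, rfl⟩, by simp [ρ_zero]⟩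
    · refine ⟨_, ⟨a, -b, -c, rfl⟩, ?_⟩
      ext x i
      fin_cases i <;> simp [IsometryEquiv.mul_apply, ρ_one_apply] <;> ring
    · refine ⟨_, ⟨-a, b, -c, rfl⟩, ?_⟩
      ext x i
      fin_cases i <;> simp [IsometryEquiv.mul_apply, ρ_two_apply] <;> ring
    · refine ⟨_, ⟨-a, -b, c, rfl⟩, ?_⟩
      ext x i
      fin_cases i <;> simp [IsometryEquiv.mul_apply, ρ_three_apply] <;> ring
  mul_transl := by
    rintro j _ ⟨a, b, c, rfl⟩
    fin_cases j
    · exact ⟨_, ⟨a, b, c, rfl⟩, by simp [ρ_zero]⟩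
    · refine ⟨_, ⟨a, -b, -c, rfl⟩, ?_⟩
      ext x i
      fin_cases i <;> simp [IsometryEquiv.mul_apply, ρ_one_apply] <;> ring
    · refine ⟨_, ⟨-a, b, -c, rfl⟩, ?_⟩
      ext x i
      fin_cases i <;> simp [IsometryEquiv.mul_apply, ρ_two_apply] <;> ring
    · refine ⟨_, ⟨-a, -b, c, rfl⟩, ?_⟩
      ext x i
      fin_cases i <;> simp [IsometryEquiv.mul_apply, ρ_three_apply] <;> ring
  mul := by
    intro j k
    -- the table lists the first coordinate of `w`, divided by two
    let t : Fin 4 → Fin 4 → ℤ := ![![0, 0, 0, 0], ![0, 1, 0, -1], ![0, 1, 0, -1], ![0, 0, 0, 0]]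
    refine ⟨_, ⟨t j k, 0, 0, rfl⟩, ?_⟩
    ext x i
    fin_cases j <;> fin_cases k <;> fin_cases i <;>
      simp [t, kleinMul, IsometryEquiv.mul_apply, ρ_zero, ρ_one_apply, ρ_two_apply,
        ρ_three_apply] <;> ring

theorem Γ₁_coe : (Γ₁ : Set (E ≃ᵢ E)) =
    {γ | ∃ j : Fin 4, ∃ v ∈ lattice, γ = rot j * transl v} := by
  refine isCosetSystem_rot.closure_eq ?_ fun j => ?_
  · rintro _ rfl
    exact ⟨1, pow_one _⟩
  · have hτ : τ ∈ Subgroup.closure (transl '' lattice ∪ {τ}) :=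
      Subgroup.subset_closure (Or.inr rfl)
    exact pow_mem hτ _

theorem Γ₂_coe : (Γ₂ : Set (E ≃ᵢ E)) =
    {γ | ∃ j : Fin 4, ∃ v ∈ lattice, γ = ρ j * transl v} := by
  refine isCosetSystem_ρ.closure_eq ?_ fun j => ?_
  · rintro _ (rfl | rfl | rfl)
    exacts [⟨1, rfl⟩, ⟨2, rfl⟩, ⟨3, rfl⟩]
  · fin_cases j
    · exact one_mem _
    all_goals exact Subgroup.subset_closure (by simp)

/-- The isometries in `Γ₁`, in coordinates. -/
theorem mem_Γ₁ {γ : E ≃ᵢ E} : γ ∈ Γ₁ ↔ ∃ a b c : ℤ,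
    (∀ x, γ x = !₂[x 0 + 2 * a, x 1 + 2 * b, x 2 + c]) ∨
    (∀ x, γ x = !₂[-x 1 + 2 * a, x 0 + 2 * b, x 2 + c]) ∨
    (∀ x, γ x = !₂[-x 0 + 2 * a, -x 1 + 2 * b, x 2 + c]) ∨
    (∀ x, γ x = !₂[x 1 + 2 * a, -x 0 + 2 * b, x 2 + c]) := by
  rw [← SetLike.mem_coe, Γ₁_coe]
  constructor
  · rintro ⟨j, _, ⟨a, b, c, rfl⟩, rfl⟩
    fin_cases j
    · refine ⟨a, b, c, Or.inl fun x => ?_⟩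
      ext i
      fin_cases i <;> simp [rot]
    · refine ⟨-b, a, c, Or.inr (Or.inl fun x => ?_)⟩
      ext i
      fin_cases i <;> simp [rot, IsometryEquiv.mul_apply, τ_apply] <;> ring
    · refine ⟨-a, -b, c, Or.inr (Or.inr (Or.inl fun x => ?_))⟩
      ext i
      fin_cases i <;> simp [rot, IsometryEquiv.mul_apply, τ_sq_apply] <;> ring
    · refine ⟨b, -a, c, Or.inr (Or.inr (Or.inr fun x => ?_))⟩
      ext i
      fin_cases i <;> simp [rot, IsometryEquiv.mul_apply, τ_cube_apply] <;> ring
  · rintro ⟨a, b, c, h | h | h | h⟩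
    · refine ⟨0, _, ⟨a, b, c, rfl⟩, ?_⟩
      ext x i
      rw [h]
      fin_cases i <;> simp [rot]
    · refine ⟨1, _, ⟨b, -a, c, rfl⟩, ?_⟩
      ext x i
      rw [h]
      fin_cases i <;> simp [rot, IsometryEquiv.mul_apply, τ_apply] <;> ring
    · refine ⟨2, _, ⟨-a, -b, c, rfl⟩, ?_⟩
      ext x i
      rw [h]
      fin_cases i <;> simp [rot, IsometryEquiv.mul_apply, τ_sq_apply] <;> ring
    · refine ⟨3, _, ⟨-b, a, c, rfl⟩, ?_⟩
      ext x i
      rw [h]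
      fin_cases i <;> simp [rot, IsometryEquiv.mul_apply, τ_cube_apply] <;> ring

/-- The isometries in `Γ₂`, in coordinates. -/
theorem mem_Γ₂ {γ : E ≃ᵢ E} : γ ∈ Γ₂ ↔ ∃ a b c : ℤ,
    (∀ x, γ x = !₂[x 0 + 2 * a, x 1 + 2 * b, x 2 + c]) ∨
    (∀ x, γ x = !₂[x 0 + 1 + 2 * a, -x 1 + 2 * b, -x 2 + c]) ∨
    (∀ x, γ x = !₂[-x 0 + 2 * a, x 1 + 2 * b, -x 2 + c]) ∨
    (∀ x, γ x = !₂[-x 0 + 1 + 2 * a, -x 1 + 2 * b, x 2 + c]) := by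
  rw [← SetLike.mem_coe, Γ₂_coe]
  constructor
  · rintro ⟨j, _, ⟨a, b, c, rfl⟩, rfl⟩
    fin_cases j
    · refine ⟨a, b, c, Or.inl fun x => ?_⟩
      ext i
      fin_cases i <;> simp [ρ_zero]
    · refine ⟨a, -b, -c, Or.inr (Or.inl fun x => ?_)⟩
      ext i
      fin_cases i <;> simp [IsometryEquiv.mul_apply, ρ_one_apply] <;> ring
    · refine ⟨-a, b, -c, Or.inr (Or.inr (Or.inl fun x => ?_))⟩
      ext i
      fin_cases i <;> simp [IsometryEquiv.mul_apply, ρ_two_apply] <;> ring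
    · refine ⟨-a, -b, c, Or.inr (Or.inr (Or.inr fun x => ?_))⟩
      ext i
      fin_cases i <;> simp [IsometryEquiv.mul_apply, ρ_three_apply] <;> ring
  · rintro ⟨a, b, c, h | h | h | h⟩
    · refine ⟨0, _, ⟨a, b, c, rfl⟩, ?_⟩
      ext x i
      rw [h]
      fin_cases i <;> simp [ρ_zero]
    · refine ⟨1, _, ⟨a, -b, -c, rfl⟩, ?_⟩
      ext x i
      rw [h]
      fin_cases i <;> simp [IsometryEquiv.mul_apply, ρ_one_apply] <;> ring
    · refine ⟨2, _, ⟨-a, b, -c, rfl⟩, ?_⟩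
      ext x i
      rw [h]
      fin_cases i <;> simp [IsometryEquiv.mul_apply, ρ_two_apply] <;> ring
    · refine ⟨3, _, ⟨-a, -b, c, rfl⟩, ?_⟩
      ext x i
      rw [h]
      fin_cases i <;> simp [IsometryEquiv.mul_apply, ρ_three_apply] <;> ring

end FlatOrbifold

end

noncomputable section

namespace FlatOrbifold

open scoped Pointwise

/-! ### Orbits, compactness and the fundamental domain -/

theorem proj_eq_proj {Γ : Subgroup (E ≃ᵢ E)} {x y : E} :
    proj Γ x = proj Γ y ↔ ∃ γ ∈ Γ, γ y = x := by
  unfold proj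
  rw [Quotient.eq, MulAction.orbitRel_apply]
  constructor
  · rintro ⟨⟨γ, hγ⟩, h⟩
    exact ⟨γ, hγ, h⟩
  · rintro ⟨γ, hγ, h⟩
    exact ⟨⟨γ, hγ⟩, h⟩

theorem ext_coord {x y : E} : x = y ↔ x 0 = y 0 ∧ x 1 = y 1 ∧ x 2 = y 2 := by
  constructor
  · rintro rfl
    exact ⟨rfl, rfl, rfl⟩
  · rintro ⟨h0, h1, h2⟩
    ext i
    fin_cases i
    exacts [h0, h1, h2]

/-- Every isometry given by one of the coordinate formulas for `Γ₁` is realized in `Γ₁`. -/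
theorem exists_mem_Γ₁ (j : Fin 4) (a b c : ℤ) : ∃ γ ∈ Γ₁, ∀ x : E, γ x =
    (![!₂[x 0 + 2 * a, x 1 + 2 * b, x 2 + c], !₂[-x 1 + 2 * a, x 0 + 2 * b, x 2 + c],
      !₂[-x 0 + 2 * a, -x 1 + 2 * b, x 2 + c],
      !₂[x 1 + 2 * a, -x 0 + 2 * b, x 2 + c]] : Fin 4 → E) j := by
  have key : ∀ x : E, (transl !₂[2 * (a : ℝ), 2 * b, c] * rot j) x =
      (![!₂[x 0 + 2 * a, x 1 + 2 * b, x 2 + c], !₂[-x 1 + 2 * a, x 0 + 2 * b, x 2 + c],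
      !₂[-x 0 + 2 * a, -x 1 + 2 * b, x 2 + c],
      !₂[x 1 + 2 * a, -x 0 + 2 * b, x 2 + c]] : Fin 4 → E) j := by
    intro x
    ext i
    fin_cases j <;> fin_cases i <;>
      simp [IsometryEquiv.mul_apply, rot, τ_apply, τ_sq_apply, τ_cube_apply]
  refine ⟨_, mem_Γ₁.2 ⟨a, b, c, ?_⟩, key⟩
  fin_cases j
  exacts [Or.inl key, Or.inr (Or.inl key), Or.inr (Or.inr (Or.inl key)),
    Or.inr (Or.inr (Or.inr key))]

/-- Every isometry given by one of the coordinate formulas for `Γ₂` is realized in `Γ₂`. -/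
theorem exists_mem_Γ₂ (j : Fin 4) (a b c : ℤ) : ∃ γ ∈ Γ₂, ∀ x : E, γ x =
    (![!₂[x 0 + 2 * a, x 1 + 2 * b, x 2 + c], !₂[x 0 + 1 + 2 * a, -x 1 + 2 * b, -x 2 + c],
      !₂[-x 0 + 2 * a, x 1 + 2 * b, -x 2 + c],
      !₂[-x 0 + 1 + 2 * a, -x 1 + 2 * b, x 2 + c]] : Fin 4 → E) j := by
  have key : ∀ x : E, (transl !₂[2 * (a : ℝ), 2 * b, c] * ρ j) x =
      (![!₂[x 0 + 2 * a, x 1 + 2 * b, x 2 + c], !₂[x 0 + 1 + 2 * a, -x 1 + 2 * b, -x 2 + c],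
      !₂[-x 0 + 2 * a, x 1 + 2 * b, -x 2 + c],
      !₂[-x 0 + 1 + 2 * a, -x 1 + 2 * b, x 2 + c]] : Fin 4 → E) j := by
    intro x
    ext i
    fin_cases j <;> fin_cases i <;>
      simp [IsometryEquiv.mul_apply, ρ_zero, ρ_one_apply, ρ_two_apply, ρ_three_apply]
  refine ⟨_, mem_Γ₂.2 ⟨a, b, c, ?_⟩, key⟩
  fin_cases j
  exacts [Or.inl key, Or.inr (Or.inl key), Or.inr (Or.inr (Or.inl key)),
    Or.inr (Or.inr (Or.inr key))]

theorem proj_Γ₁_eq {x y : E} : proj Γ₁ x = proj Γ₁ y ↔ ∃ a b c : ℤ,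
    (x 0 = y 0 + 2 * a ∧ x 1 = y 1 + 2 * b ∧ x 2 = y 2 + c) ∨
    (x 0 = -y 1 + 2 * a ∧ x 1 = y 0 + 2 * b ∧ x 2 = y 2 + c) ∨
    (x 0 = -y 0 + 2 * a ∧ x 1 = -y 1 + 2 * b ∧ x 2 = y 2 + c) ∨
    (x 0 = y 1 + 2 * a ∧ x 1 = -y 0 + 2 * b ∧ x 2 = y 2 + c) := by
  rw [proj_eq_proj]
  constructor
  · rintro ⟨γ, hγ, rfl⟩
    obtain ⟨a, b, c, h | h | h | h⟩ := mem_Γ₁.1 hγ <;> refine ⟨a, b, c, ?_⟩ <;> simp [h]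
  · rintro ⟨a, b, c, h | h | h | h⟩
    · obtain ⟨γ, hγ, e⟩ := exists_mem_Γ₁ 0 a b c
      exact ⟨γ, hγ, by rw [e, ext_coord]; simp [h]⟩
    · obtain ⟨γ, hγ, e⟩ := exists_mem_Γ₁ 1 a b c
      exact ⟨γ, hγ, by rw [e, ext_coord]; simp [h]⟩
    · obtain ⟨γ, hγ, e⟩ := exists_mem_Γ₁ 2 a b c
      exact ⟨γ, hγ, by rw [e, ext_coord]; simp [h]⟩
    · obtain ⟨γ, hγ, e⟩ := exists_mem_Γ₁ 3 a b c
      exact ⟨γ, hγ, by rw [e, ext_coord]; simp [h]⟩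

theorem proj_Γ₂_eq {x y : E} : proj Γ₂ x = proj Γ₂ y ↔ ∃ a b c : ℤ,
    (x 0 = y 0 + 2 * a ∧ x 1 = y 1 + 2 * b ∧ x 2 = y 2 + c) ∨
    (x 0 = y 0 + 1 + 2 * a ∧ x 1 = -y 1 + 2 * b ∧ x 2 = -y 2 + c) ∨
    (x 0 = -y 0 + 2 * a ∧ x 1 = y 1 + 2 * b ∧ x 2 = -y 2 + c) ∨
    (x 0 = -y 0 + 1 + 2 * a ∧ x 1 = -y 1 + 2 * b ∧ x 2 = y 2 + c) := by
  rw [proj_eq_proj]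
  constructor
  · rintro ⟨γ, hγ, rfl⟩
    obtain ⟨a, b, c, h | h | h | h⟩ := mem_Γ₂.1 hγ <;> refine ⟨a, b, c, ?_⟩ <;> simp [h]
  · rintro ⟨a, b, c, h | h | h | h⟩
    · obtain ⟨γ, hγ, e⟩ := exists_mem_Γ₂ 0 a b c
      exact ⟨γ, hγ, by rw [e, ext_coord]; simp [h]⟩
    · obtain ⟨γ, hγ, e⟩ := exists_mem_Γ₂ 1 a b c
      exact ⟨γ, hγ, by rw [e, ext_coord]; simp [h]⟩
    · obtain ⟨γ, hγ, e⟩ := exists_mem_Γ₂ 2 a b c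
      exact ⟨γ, hγ, by rw [e, ext_coord]; simp [h]⟩
    · obtain ⟨γ, hγ, e⟩ := exists_mem_Γ₂ 3 a b c
      exact ⟨γ, hγ, by rw [e, ext_coord]; simp [h]⟩

theorem finite_lattice_inter {K : Set E} (hK : Bornology.IsBounded K) :
    (lattice ∩ K).Finite := by
  obtain ⟨R, hR⟩ := hK.exists_norm_le
  obtain ⟨N, hN⟩ := exists_nat_ge R
  have hfin : (Set.Icc (-(N : ℤ)) N ×ˢ Set.Icc (-(N : ℤ)) N ×ˢ Set.Icc (-(N : ℤ)) N).Finite :=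
    (Set.finite_Icc _ _).prod ((Set.finite_Icc _ _).prod (Set.finite_Icc _ _))
  refine (hfin.image fun p : ℤ × ℤ × ℤ =>
    (!₂[2 * (p.1 : ℝ), 2 * (p.2.1 : ℝ), (p.2.2 : ℝ)] : E)).subset ?_
  rintro _ ⟨⟨a, b, c, rfl⟩, hv⟩
  have h : ∀ i, |(!₂[2 * (a : ℝ), 2 * (b : ℝ), (c : ℝ)] : E) i| ≤ N := fun i =>
    (PiLp.norm_apply_le _ i).trans ((hR _ hv).trans hN)
  have ha := abs_le.1 (h 0)
  have hb := abs_le.1 (h 1)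
  have hc := abs_le.1 (h 2)
  simp only [Matrix.cons_val] at ha hb hc
  have ha' : -(N : ℤ) ≤ 2 * a ∧ 2 * a ≤ N := by exact_mod_cast ha
  have hb' : -(N : ℤ) ≤ 2 * b ∧ 2 * b ≤ N := by exact_mod_cast hb
  have hc' : -(N : ℤ) ≤ c ∧ c ≤ N := by exact_mod_cast hc
  refine ⟨(a, b, c), ?_, rfl⟩
  simp only [Set.mem_prod, Set.mem_Icc]
  omega

theorem isCompact_unitCube : IsCompact unitCube := by
  have h : unitCube = PiLp.homeomorph 2 (fun _ : Fin 3 => ℝ) ⁻¹'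
      Set.univ.pi fun _ => Set.Icc (0 : ℝ) 1 := by
    ext x
    simp [unitCube, PiLp.homeomorph, Pi.le_def, forall_and]
  rw [h, Homeomorph.isCompact_preimage]
  exact isCompact_univ_pi fun _ => isCompact_Icc

/-- A group with finitely many cosets modulo the lattice and a compact fundamental domain has a
compact flat orbifold as its quotient. -/
theorem isCompactFlatOrbifold_of_coset {Γ : Subgroup (E ≃ᵢ E)} (g : Fin 4 → E ≃ᵢ E)
    (hΓ : (Γ : Set (E ≃ᵢ E)) = {γ | ∃ j : Fin 4, ∃ v ∈ lattice, γ = g j * transl v})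
    (hD : IsFundDomain Γ unitCube) : IsCompactFlatOrbifold Γ := by
  refine ⟨⟨fun {K L} hK hL => ?_⟩, ⟨?_⟩⟩
  · -- `g j (x + v) ∈ L` with `x ∈ K` confines `v` to the bounded set `g j ⁻¹ L - K`
    have hfin : (⋃ j : Fin 4, (fun v => g j * transl v) ''
        (lattice ∩ ((g j).symm '' L - K))).Finite :=
      Set.finite_iUnion fun j => (finite_lattice_inter
        ((hL.image (g j).symm.continuous).isBounded.sub hK.isBounded)).image _
    refine Set.Finite.of_finite_image (f := Subtype.val) (hfin.subset ?_)
      Subtype.val_injective.injOn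
    rintro _ ⟨⟨γ, hγ⟩, hne, rfl⟩
    have hγ' : γ ∈ (Γ : Set (E ≃ᵢ E)) := hγ
    rw [hΓ] at hγ'
    obtain ⟨j, v, hv, rfl⟩ := hγ'
    obtain ⟨y, ⟨x, hx, rfl⟩, hy⟩ := hne
    refine Set.mem_iUnion.2 ⟨j, v, ⟨hv, ?_⟩, rfl⟩
    refine ⟨x + v, ⟨_, hy, ?_⟩, x, hx, add_sub_cancel_left x v⟩
    exact (g j).symm_apply_apply (x + v)
  · have h : (Set.univ : Set (Orbifold Γ)) = proj Γ '' unitCube := by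
      refine (Set.eq_univ_of_forall fun q => ?_).symm
      obtain ⟨x, rfl⟩ := Quotient.exists_rep q
      obtain ⟨γ, hγ, hx⟩ := hD.1 x
      exact ⟨γ x, hx, proj_eq_proj.2 ⟨γ, hγ, rfl⟩⟩
    rw [h]
    exact isCompact_unitCube.image continuous_quotient_mk'

theorem mem_Ioo_of_mem_interior_unitCube {x : E} (hx : x ∈ interior unitCube) (i : Fin 3) :
    0 < x i ∧ x i < 1 := by
  have hopen : IsOpenMap fun y : E => y i :=
    (isOpenMap_eval i).comp (PiLp.homeomorph 2 (fun _ : Fin 3 => ℝ)).isOpenMap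
  have hsub : (fun y : E => y i) '' interior unitCube ⊆ Set.Icc 0 1 := by
    rintro _ ⟨y, hy, rfl⟩
    exact interior_subset hy i
  have h := interior_maximal hsub (hopen _ isOpen_interior) ⟨x, hx, rfl⟩
  rwa [interior_Icc] at h

/-- Division with remainder in an interval of length two. -/
theorem exists_add_two_mul (t : ℝ) : ∃ a : ℤ, -1 ≤ t + 2 * a ∧ t + 2 * a ≤ 1 := by
  refine ⟨-⌊(t + 1) / 2⌋, ?_, ?_⟩
  · have := Int.floor_le ((t + 1) / 2)
    push_cast; linarith
  · have := Int.lt_floor_add_one ((t + 1) / 2)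
    push_cast; linarith

/-- Division with remainder in an interval of length one. -/
theorem exists_add_int (t : ℝ) : ∃ c : ℤ, 0 ≤ t + c ∧ t + c ≤ 1 := by
  refine ⟨-⌊t⌋, ?_, ?_⟩
  · have := Int.floor_le t
    push_cast; linarith
  · have := Int.lt_floor_add_one t
    push_cast; linarith

theorem mem_unitCube {x : E} : x ∈ unitCube ↔
    (0 ≤ x 0 ∧ x 0 ≤ 1) ∧ (0 ≤ x 1 ∧ x 1 ≤ 1) ∧ (0 ≤ x 2 ∧ x 2 ≤ 1) := by
  simp [unitCube, Fin.forall_fin_succ]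

/-- After a translation by `lattice`, the first two coordinates lie in the square `[-1, 1]²`, whose
four quadrants are permuted by the quarter rotation. -/
theorem exists_mem_unitCube_Γ₁ (x : E) : ∃ γ ∈ Γ₁, γ x ∈ unitCube := by
  obtain ⟨a, ha, ha'⟩ := exists_add_two_mul (x 0)
  obtain ⟨b, hb, hb'⟩ := exists_add_two_mul (x 1)
  obtain ⟨c, hc, hc'⟩ := exists_add_int (x 2)
  rcases le_total 0 (x 0 + 2 * a) with h0 | h0 <;> rcases le_total 0 (x 1 + 2 * b) with h1 | h1
  · obtain ⟨γ, hγ, e⟩ := exists_mem_Γ₁ 0 a b c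
    refine ⟨γ, hγ, ?_⟩
    rw [e, mem_unitCube]
    simp only [Matrix.cons_val]
    refine ⟨⟨?_, ?_⟩, ⟨?_, ?_⟩, ?_, ?_⟩ <;> linarith
  · obtain ⟨γ, hγ, e⟩ := exists_mem_Γ₁ 1 (-b) a c
    refine ⟨γ, hγ, ?_⟩
    rw [e, mem_unitCube]
    simp only [Matrix.cons_val]
    push_cast
    refine ⟨⟨?_, ?_⟩, ⟨?_, ?_⟩, ?_, ?_⟩ <;> linarith
  · obtain ⟨γ, hγ, e⟩ := exists_mem_Γ₁ 3 b (-a) c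
    refine ⟨γ, hγ, ?_⟩
    rw [e, mem_unitCube]
    simp only [Matrix.cons_val]
    push_cast
    refine ⟨⟨?_, ?_⟩, ⟨?_, ?_⟩, ?_, ?_⟩ <;> linarith
  · obtain ⟨γ, hγ, e⟩ := exists_mem_Γ₁ 2 (-a) (-b) c
    refine ⟨γ, hγ, ?_⟩
    rw [e, mem_unitCube]
    simp only [Matrix.cons_val]
    push_cast
    refine ⟨⟨?_, ?_⟩, ⟨?_, ?_⟩, ?_, ?_⟩ <;> linarith

/-- After a translation by `lattice`, the first two coordinates lie in the square `[-1, 1]²`, each of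
whose quadrants is moved to `[0, 1]²` by an isometry in another coset of `lattice`. -/
theorem exists_mem_unitCube_Γ₂ (x : E) : ∃ γ ∈ Γ₂, γ x ∈ unitCube := by
  obtain ⟨a, ha, ha'⟩ := exists_add_two_mul (x 0)
  obtain ⟨b, hb, hb'⟩ := exists_add_two_mul (x 1)
  obtain ⟨c, hc, hc'⟩ := exists_add_int (x 2)
  obtain ⟨d, hd, hd'⟩ := exists_add_int (-x 2)
  rcases le_total 0 (x 0 + 2 * a) with h0 | h0 <;> rcases le_total 0 (x 1 + 2 * b) with h1 | h1
  · obtain ⟨γ, hγ, e⟩ := exists_mem_Γ₂ 0 a b c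
    refine ⟨γ, hγ, ?_⟩
    rw [e, mem_unitCube]
    simp only [Matrix.cons_val]
    refine ⟨⟨?_, ?_⟩, ⟨?_, ?_⟩, ?_, ?_⟩ <;> linarith
  · obtain ⟨γ, hγ, e⟩ := exists_mem_Γ₂ 3 (-a) (-b) c
    refine ⟨γ, hγ, ?_⟩
    rw [e, mem_unitCube]
    simp only [Matrix.cons_val]
    push_cast
    refine ⟨⟨?_, ?_⟩, ⟨?_, ?_⟩, ?_, ?_⟩ <;> linarith
  · obtain ⟨γ, hγ, e⟩ := exists_mem_Γ₂ 2 (-a) b d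
    refine ⟨γ, hγ, ?_⟩
    rw [e, mem_unitCube]
    simp only [Matrix.cons_val]
    push_cast
    refine ⟨⟨?_, ?_⟩, ⟨?_, ?_⟩, ?_, ?_⟩ <;> linarith
  · obtain ⟨γ, hγ, e⟩ := exists_mem_Γ₂ 1 a (-b) d
    refine ⟨γ, hγ, ?_⟩
    rw [e, mem_unitCube]
    simp only [Matrix.cons_val]
    push_cast
    refine ⟨⟨?_, ?_⟩, ⟨?_, ?_⟩, ?_, ?_⟩ <;> linarith

/-- Only the translation by zero moves a point of the open interval `(0, 1)` into it by an integral
amount. -/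
theorem eq_zero_of_unit_interval {t : ℝ} {n : ℤ} (h : 0 < t ∧ t < 1)
    (h' : 0 < t + n ∧ t + n < 1) : n = 0 := by
  have h1 : (n : ℝ) < 1 := by linarith
  have h2 : (-1 : ℝ) < n := by linarith
  have h1' : n < 1 := by exact_mod_cast h1
  have h2' : -1 < n := by exact_mod_cast h2
  omega

theorem not_even_reflection {t s : ℝ} {n : ℤ} (ht : 0 < t ∧ t < 1) (hs : 0 < s ∧ s < 1)
    (h : s = -t + 2 * n) : False := by
  have h1 : (0 : ℝ) < n := by linarith
  have h2 : (n : ℝ) < 1 := by linarith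
  have h1' : 0 < n := by exact_mod_cast h1
  have h2' : n < 1 := by exact_mod_cast h2
  omega

theorem not_odd_translation {t s : ℝ} {n : ℤ} (ht : 0 < t ∧ t < 1) (hs : 0 < s ∧ s < 1)
    (h : s = t + 1 + 2 * n) : False := by
  have h1 : (-1 : ℝ) < n := by linarith
  have h2 : (n : ℝ) < 0 := by linarith
  have h1' : -1 < n := by exact_mod_cast h1
  have h2' : n < 0 := by exact_mod_cast h2
  omega

theorem eq_one_of_translation {γ : E ≃ᵢ E} {a b c : ℤ}
    (h : ∀ x, γ x = !₂[x 0 + 2 * a, x 1 + 2 * b, x 2 + c]) {x : E}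
    (hx : ∀ i, 0 < x i ∧ x i < 1) (hγ : ∀ i, 0 < γ x i ∧ γ x i < 1) : γ = 1 := by
  have h0 := hγ 0
  have h1 := hγ 1
  have h2 := hγ 2
  rw [h] at h0 h1 h2
  simp only [Matrix.cons_val] at h0 h1 h2
  have ha := eq_zero_of_unit_interval (n := 2 * a) (hx 0) (by push_cast; exact h0)
  have hb := eq_zero_of_unit_interval (n := 2 * b) (hx 1) (by push_cast; exact h1)
  have hc := eq_zero_of_unit_interval (hx 2) h2
  obtain rfl : a = 0 := by omega
  obtain rfl : b = 0 := by omega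
  ext y : 1
  rw [h, ext_coord]
  simp [hc]

theorem isFundDomain_Γ₁ : IsFundDomain Γ₁ unitCube := by
  refine ⟨exists_mem_unitCube_Γ₁, fun γ hγ hne => ?_⟩
  rw [Set.disjoint_left]
  rintro _ ⟨x, hx, rfl⟩ hy
  replace hx := mem_Ioo_of_mem_interior_unitCube hx
  replace hy := mem_Ioo_of_mem_interior_unitCube hy
  obtain ⟨a, b, c, h | h | h | h⟩ := mem_Γ₁.1 hγ
  · exact hne (eq_one_of_translation h hx hy)
  · exact not_even_reflection (hx 1) (hy 0) (n := a) (by simp [h])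
  · exact not_even_reflection (hx 0) (hy 0) (n := a) (by simp [h])
  · exact not_even_reflection (hx 0) (hy 1) (n := b) (by simp [h])

theorem isFundDomain_Γ₂ : IsFundDomain Γ₂ unitCube := by
  refine ⟨exists_mem_unitCube_Γ₂, fun γ hγ hne => ?_⟩
  rw [Set.disjoint_left]
  rintro _ ⟨x, hx, rfl⟩ hy
  replace hx := mem_Ioo_of_mem_interior_unitCube hx
  replace hy := mem_Ioo_of_mem_interior_unitCube hy
  obtain ⟨a, b, c, h | h | h | h⟩ := mem_Γ₂.1 hγ
  · exact hne (eq_one_of_translation h hx hy)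
  · exact not_odd_translation (hx 0) (hy 0) (n := a) (by simp [h])
  · exact not_even_reflection (hx 0) (hy 0) (n := a) (by simp [h])
  · exact not_even_reflection (hx 1) (hy 1) (n := b) (by simp [h])

end FlatOrbifold

end

noncomputable section

namespace FlatOrbifold

/-! ### Isotropy groups and singular sets -/

theorem nonempty_stab_mulEquiv {Γ : Subgroup (E ≃ᵢ E)} {x : E} {γ : E ≃ᵢ E} {n : ℕ} (hγ : γ ∈ Γ)
    (hx : γ x = x) (hn : orderOf γ = n) (h : ∀ δ ∈ Γ, δ x = x → δ ∈ Subgroup.zpowers γ) :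
    Nonempty (stab Γ x ≃* Cyc n) := by
  let g : stab Γ x := ⟨⟨γ, hγ⟩, hx⟩
  have hg : ∀ d : stab Γ x, d ∈ Subgroup.zpowers g := by
    rintro ⟨⟨δ, hδ⟩, hδx⟩
    obtain ⟨k, hk⟩ := h δ hδ hδx
    exact ⟨k, Subtype.ext (Subtype.ext hk)⟩
  have hc : IsCyclic (stab Γ x) := ⟨g, hg⟩
  have ho : orderOf g = n := by
    rw [← hn, ← Subgroup.orderOf_coe g, ← Subgroup.orderOf_coe]
  rw [← ho, orderOf_eq_card_of_forall_mem_zpowers hg]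
  exact ⟨(zmodCyclicMulEquiv hc).symm⟩

theorem stab_eq_bot {Γ : Subgroup (E ≃ᵢ E)} {x : E} (h : ∀ δ ∈ Γ, δ x = x → δ = 1) :
    stab Γ x = ⊥ := by
  rw [Subgroup.eq_bot_iff_forall]
  rintro ⟨δ, hδ⟩ hx
  exact Subtype.ext (h δ hδ hx)

theorem hasIsotropy_proj {Γ : Subgroup (E ≃ᵢ E)} {x : E} {G : Type} [Group G]
    (h : Nonempty (stab Γ x ≃* G)) : HasIsotropy Γ (proj Γ x) G := by
  intro y hy
  obtain ⟨e⟩ := h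
  have hr : MulAction.orbitRel Γ E y x := Quotient.exact hy
  exact ⟨(MulAction.stabilizerEquivStabilizerOfOrbitRel hr).trans e⟩

theorem card_stab {Γ : Subgroup (E ≃ᵢ E)} {x : E} {n : ℕ}
    (h : HasIsotropy Γ (proj Γ x) (Cyc n)) : Nat.card (stab Γ x) = n := by
  obtain ⟨e⟩ := h x rfl
  rw [Nat.card_congr e.toEquiv, Nat.card_congr Multiplicative.toAdd, Nat.card_zmod]

section Axes

variable {ι : Type*} {Γ : Subgroup (E ≃ᵢ E)} {p u : ι → E} {n : ι → ℕ}

theorem singularSet_eq_iUnion_lineImage (hn : ∀ i, 1 < n i)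
    (h1 : ∀ i, ∀ q ∈ lineImage Γ (p i) (u i), HasIsotropy Γ q (Cyc (n i)))
    (h2 : ∀ x, stab Γ x ≠ ⊥ → ∃ i, proj Γ x ∈ lineImage Γ (p i) (u i)) :
    singularSet Γ = ⋃ i, lineImage Γ (p i) (u i) := by
  ext q
  rw [Set.mem_iUnion]
  constructor
  · rintro ⟨x, rfl, hx⟩
    exact h2 x hx
  · rintro ⟨i, hq⟩
    obtain ⟨x, rfl⟩ := Quotient.exists_rep q
    refine ⟨x, rfl, fun hbot => ?_⟩
    have h := card_stab (h1 i _ hq)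
    rw [hbot, Subgroup.card_bot] at h
    exact (hn i).ne h

theorem isMaxIsotropyOrder_of_lineImage {N : ℕ} (hn : ∀ i, 1 < n i) (hN : 1 ≤ N)
    (hle : ∀ i, n i ≤ N) (hex : ∃ i, n i = N)
    (h1 : ∀ i, ∀ q ∈ lineImage Γ (p i) (u i), HasIsotropy Γ q (Cyc (n i)))
    (h2 : ∀ x, stab Γ x ≠ ⊥ → ∃ i, proj Γ x ∈ lineImage Γ (p i) (u i)) :
    IsMaxIsotropyOrder Γ N := by
  have key : ∀ x, 1 ≤ Nat.card (stab Γ x) ∧ Nat.card (stab Γ x) ≤ N := by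
    intro x
    by_cases hx : stab Γ x = ⊥
    · rw [hx, Subgroup.card_bot]
      exact ⟨le_rfl, hN⟩
    · obtain ⟨i, hi⟩ := h2 x hx
      rw [card_stab (h1 i _ hi)]
      exact ⟨(hn i).le, hle i⟩
  refine ⟨fun x => Nat.finite_of_card_ne_zero (by have := key x; omega), ?_, ?_⟩
  · obtain ⟨i, rfl⟩ := hex
    exact ⟨p i + (0 : ℝ) • u i, card_stab (h1 i _ ⟨0, rfl⟩)⟩
  · rintro _ ⟨x, rfl⟩
    exact (key x).2

end Axes

theorem one_isometry_apply (x : E) : (1 : E ≃ᵢ E) x = x := rfl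

theorem eq_one_of_translation_of_fixed {γ : E ≃ᵢ E} {a b c : ℤ}
    (h : ∀ x, γ x = !₂[x 0 + 2 * a, x 1 + 2 * b, x 2 + c]) {x : E} (hx : γ x = x) : γ = 1 := by
  rw [h, ext_coord] at hx
  simp only [Matrix.cons_val] at hx
  obtain ⟨hx0, hx1, hx2⟩ := hx
  ext y : 1
  rw [h, ext_coord]
  simp only [Matrix.cons_val, one_isometry_apply]
  refine ⟨?_, ?_, ?_⟩ <;> linarith

/-- The vertical line through a point whose first two coordinates are integers of the same parity
is the axis of a rotation of order four. -/
theorem stab_Γ₁_four {x : E} {a b : ℤ} (h0 : x 0 = a - b) (h1 : x 1 = a + b) :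
    Nonempty (stab Γ₁ x ≃* Cyc 4) := by
  obtain ⟨γ, hγ, e⟩ := exists_mem_Γ₁ 1 a b 0
  simp only [Matrix.cons_val, Int.cast_zero, add_zero] at e
  have e2 : ∀ y, (γ ^ 2) y = !₂[-y 0 + 2 * (a - b), -y 1 + 2 * (a + b), y 2] := by
    intro y
    rw [pow_two, IsometryEquiv.mul_apply, e, e, ext_coord]
    simp only [Matrix.cons_val]
    refine ⟨?_, ?_, trivial⟩ <;> ring
  have e3 : ∀ y, (γ ^ 3) y = !₂[y 1 - 2 * b, -y 0 + 2 * a, y 2] := by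
    intro y
    rw [pow_succ, IsometryEquiv.mul_apply, e, e2, ext_coord]
    simp only [Matrix.cons_val]
    refine ⟨?_, ?_, trivial⟩ <;> ring
  have e4 : γ ^ 4 = 1 := by
    ext y : 1
    rw [pow_succ, IsometryEquiv.mul_apply, e, e3, ext_coord]
    simp only [Matrix.cons_val, one_isometry_apply]
    refine ⟨?_, ?_, trivial⟩ <;> ring
  have hne : γ ^ 2 ≠ 1 := by
    intro h
    have h' := congrArg (fun g : E ≃ᵢ E => g !₂[a - b + 1, 0, 0] 0) h
    simp only [e2, one_isometry_apply, Matrix.cons_val] at h'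
    linarith
  refine nonempty_stab_mulEquiv hγ ?_ (orderOf_eq_prime_pow (p := 2) (n := 1) hne e4) ?_
  · rw [e, ext_coord]
    simp only [Matrix.cons_val]
    refine ⟨?_, ?_, trivial⟩ <;> linarith
  · intro δ hδ hfix
    have hx := ext_coord.1 hfix
    obtain ⟨a', b', c', h | h | h | h⟩ := mem_Γ₁.1 hδ <;> rw [h] at hx <;>
      simp only [Matrix.cons_val] at hx <;> obtain ⟨hx0, hx1, hx2⟩ := hx
    · rw [eq_one_of_translation_of_fixed h hfix]
      exact one_mem _
    · have : δ = γ ^ 1 := by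
        ext y : 1
        rw [h, pow_one, e, ext_coord]
        simp only [Matrix.cons_val]
        refine ⟨?_, ?_, ?_⟩ <;> linarith
      rw [this]
      exact Subgroup.npow_mem_zpowers γ 1
    · have : δ = γ ^ 2 := by
        ext y : 1
        rw [h, e2, ext_coord]
        simp only [Matrix.cons_val]
        refine ⟨?_, ?_, ?_⟩ <;> linarith
      rw [this]
      exact Subgroup.npow_mem_zpowers γ 2
    · have : δ = γ ^ 3 := by
        ext y : 1
        rw [h, e3, ext_coord]
        simp only [Matrix.cons_val]
        refine ⟨?_, ?_, ?_⟩ <;> linarith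
      rw [this]
      exact Subgroup.npow_mem_zpowers γ 3

/-- The parity obstruction behind all case distinctions below: a real equation that would make `1`
an even integer. -/
theorem two_mul_cast_ne_one (m : ℤ) (h : 2 * (m : ℝ) = 1) : False := by
  have : 2 * m = 1 := by exact_mod_cast h
  omega

/-- The stabilizer of a fixed point of an involution `γ` has order two if it contains no other
isometry. -/
theorem nonempty_stab_mulEquiv_two {Γ : Subgroup (E ≃ᵢ E)} {x : E} {γ : E ≃ᵢ E} (hγ : γ ∈ Γ)
    (hx : γ x = x) (h2 : γ ^ 2 = 1) (h1 : γ ≠ 1) (h : ∀ δ ∈ Γ, δ x = x → δ = 1 ∨ δ = γ) :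
    Nonempty (stab Γ x ≃* Cyc 2) := by
  refine nonempty_stab_mulEquiv hγ hx (orderOf_eq_prime h2 h1) fun δ hδ hδx => ?_
  rcases h δ hδ hδx with rfl | rfl
  exacts [one_mem _, Subgroup.mem_zpowers _]

/-- The vertical line through a point whose first two coordinates are integers of different parity
is the axis of a half-turn, but of no rotation of order four. -/
theorem stab_Γ₁_two {x : E} {p q k : ℤ} (h0 : x 0 = p) (h1 : x 1 = q) (hpq : p + q = 2 * k + 1) :
    Nonempty (stab Γ₁ x ≃* Cyc 2) := by
  have hpq' : (p : ℝ) + q = 2 * k + 1 := by exact_mod_cast hpq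
  obtain ⟨γ, hγ, e⟩ := exists_mem_Γ₁ 2 p q 0
  simp only [Matrix.cons_val, Int.cast_zero, add_zero] at e
  refine nonempty_stab_mulEquiv_two hγ ?_ ?_ ?_ ?_
  · rw [e, ext_coord]
    simp only [Matrix.cons_val]
    refine ⟨?_, ?_, trivial⟩ <;> linarith
  · ext y : 1
    rw [pow_two, IsometryEquiv.mul_apply, e, e, ext_coord]
    simp only [Matrix.cons_val, one_isometry_apply]
    refine ⟨?_, ?_, trivial⟩ <;> ring
  · intro h
    have h' := congrArg (fun g : E ≃ᵢ E => g !₂[p + 1, 0, 0] 0) h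
    simp only [e, one_isometry_apply, Matrix.cons_val] at h'
    linarith
  · intro δ hδ hfix
    have hx := ext_coord.1 hfix
    obtain ⟨a', b', c', h | h | h | h⟩ := mem_Γ₁.1 hδ <;> rw [h] at hx <;>
      simp only [Matrix.cons_val] at hx <;> obtain ⟨hx0, hx1, hx2⟩ := hx
    · exact Or.inl (eq_one_of_translation_of_fixed h hfix)
    · exact (two_mul_cast_ne_one (a' - k) (by push_cast; linarith)).elim
    · right
      ext y : 1
      rw [h, e, ext_coord]
      simp only [Matrix.cons_val]
      refine ⟨?_, ?_, ?_⟩ <;> linarith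
    · exact (two_mul_cast_ne_one (a' + q - k) (by push_cast; linarith)).elim

/-- The lines in direction `e₂` through the points `(p, 0, q / 2)` are axes of half-turns. -/
theorem stab_Γ₂_dir_two {x : E} {p q : ℤ} (h0 : x 0 = p) (h2 : 2 * x 2 = q) :
    Nonempty (stab Γ₂ x ≃* Cyc 2) := by
  obtain ⟨γ, hγ, e⟩ := exists_mem_Γ₂ 2 p 0 q
  simp only [Matrix.cons_val, Int.cast_zero, mul_zero, add_zero] at e
  refine nonempty_stab_mulEquiv_two hγ ?_ ?_ ?_ ?_
  · rw [e, ext_coord]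
    simp only [Matrix.cons_val]
    refine ⟨?_, trivial, ?_⟩ <;> linarith
  · ext y : 1
    rw [pow_two, IsometryEquiv.mul_apply, e, e, ext_coord]
    simp only [Matrix.cons_val, one_isometry_apply]
    refine ⟨?_, trivial, ?_⟩ <;> ring
  · intro h
    have h' := congrArg (fun g : E ≃ᵢ E => g !₂[p + 1, 0, 0] 0) h
    simp only [e, one_isometry_apply, Matrix.cons_val] at h'
    linarith
  · intro δ hδ hfix
    have hx := ext_coord.1 hfix
    obtain ⟨a', b', c', h | h | h | h⟩ := mem_Γ₂.1 hδ <;> rw [h] at hx <;>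
      simp only [Matrix.cons_val] at hx <;> obtain ⟨hx0, hx1, hx2⟩ := hx
    · exact Or.inl (eq_one_of_translation_of_fixed h hfix)
    · exact (two_mul_cast_ne_one (-a') (by push_cast; linarith)).elim
    · right
      ext y : 1
      rw [h, e, ext_coord]
      simp only [Matrix.cons_val]
      refine ⟨?_, ?_, ?_⟩ <;> linarith
    · exact (two_mul_cast_ne_one (p - a') (by push_cast; linarith)).elim

/-- The vertical lines through the points `(p + 1 / 2, q, 0)` are axes of half-turns. -/
theorem stab_Γ₂_dir_three {x : E} {p q : ℤ} (h0 : x 0 = p + 1 / 2) (h1 : x 1 = q) :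
    Nonempty (stab Γ₂ x ≃* Cyc 2) := by
  obtain ⟨γ, hγ, e⟩ := exists_mem_Γ₂ 3 p q 0
  simp only [Matrix.cons_val, Int.cast_zero, add_zero] at e
  refine nonempty_stab_mulEquiv_two hγ ?_ ?_ ?_ ?_
  · rw [e, ext_coord]
    simp only [Matrix.cons_val]
    refine ⟨?_, ?_, trivial⟩ <;> linarith
  · ext y : 1
    rw [pow_two, IsometryEquiv.mul_apply, e, e, ext_coord]
    simp only [Matrix.cons_val, one_isometry_apply]
    refine ⟨?_, ?_, trivial⟩ <;> ring
  · intro h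
    have h' := congrArg (fun g : E ≃ᵢ E => g !₂[0, q + 1, 0] 1) h
    simp only [e, one_isometry_apply, Matrix.cons_val] at h'
    linarith
  · intro δ hδ hfix
    have hx := ext_coord.1 hfix
    obtain ⟨a', b', c', h | h | h | h⟩ := mem_Γ₂.1 hδ <;> rw [h] at hx <;>
      simp only [Matrix.cons_val] at hx <;> obtain ⟨hx0, hx1, hx2⟩ := hx
    · exact Or.inl (eq_one_of_translation_of_fixed h hfix)
    · exact (two_mul_cast_ne_one (-a') (by push_cast; linarith)).elim
    · exact (two_mul_cast_ne_one (a' - p) (by push_cast; linarith)).elim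
    · right
      ext y : 1
      rw [h, e, ext_coord]
      simp only [Matrix.cons_val]
      refine ⟨?_, ?_, ?_⟩ <;> linarith

theorem hasIsotropy_lineImage_Γ₁ (i : Fin 3) :
    ∀ q ∈ lineImage Γ₁ (axisPoint₁ i) e₃, HasIsotropy Γ₁ q (Cyc ((![4, 4, 2] : Fin 3 → ℕ) i)) := by
  rintro _ ⟨t, rfl⟩
  refine hasIsotropy_proj ?_
  fin_cases i
  · exact stab_Γ₁_four (a := 0) (b := 0) (by simp [axisPoint₁, e₃]) (by simp [axisPoint₁, e₃])
  · exact stab_Γ₁_four (a := 1) (b := 0) (by simp [axisPoint₁, e₃]) (by simp [axisPoint₁, e₃])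
  · exact stab_Γ₁_two (p := 0) (q := 1) (k := 0) (by simp [axisPoint₁, e₃])
      (by simp [axisPoint₁, e₃]) rfl

theorem hasIsotropy_lineImage_Γ₂ (i : Fin 4) :
    ∀ q ∈ lineImage Γ₂ (axisPoint₂ i) (axisDir₂ i), HasIsotropy Γ₂ q (Cyc 2) := by
  rintro _ ⟨t, rfl⟩
  refine hasIsotropy_proj ?_
  fin_cases i
  · exact stab_Γ₂_dir_two (p := 0) (q := 0) (by simp [axisPoint₂, axisDir₂, e₂])
      (by simp [axisPoint₂, axisDir₂, e₂])
  · exact stab_Γ₂_dir_two (p := 0) (q := 1) (by simp [axisPoint₂, axisDir₂, e₂])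
      (by simp [axisPoint₂, axisDir₂, e₂])
  · exact stab_Γ₂_dir_three (p := 0) (q := 0) (by simp [axisPoint₂, axisDir₂, e₃])
      (by simp [axisPoint₂, axisDir₂, e₃])
  · exact stab_Γ₂_dir_three (p := 0) (q := 1) (by simp [axisPoint₂, axisDir₂, e₃])
      (by simp [axisPoint₂, axisDir₂, e₃])

theorem exists_fixing_of_stab_ne_bot {Γ : Subgroup (E ≃ᵢ E)} {x : E} (hx : stab Γ x ≠ ⊥) :
    ∃ γ ∈ Γ, γ x = x ∧ γ ≠ 1 := by
  by_contra! h
  exact hx (stab_eq_bot fun δ hδ hδx => h δ hδ hδx)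

/-- A point with integral first two coordinates lies over one of the three axes of `Γ₁`,
according to the parities. -/
theorem proj_mem_lineImage_Γ₁ {x : E} {p q : ℤ} (h0 : x 0 = p) (h1 : x 1 = q) :
    ∃ i, proj Γ₁ x ∈ lineImage Γ₁ (axisPoint₁ i) e₃ := by
  rcases Int.even_or_odd' p with ⟨k, rfl | rfl⟩ <;> rcases Int.even_or_odd' q with ⟨m, rfl | rfl⟩
  · exact ⟨0, x 2, (proj_Γ₁_eq.2 ⟨k, m, 0, Or.inl (by simp [axisPoint₁, e₃, h0, h1])⟩).symm⟩
  · exact ⟨2, x 2, (proj_Γ₁_eq.2 ⟨k, m, 0, Or.inl (by simp [axisPoint₁, e₃, h0, h1]; ring)⟩).symm⟩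
  · refine ⟨2, x 2, (proj_Γ₁_eq.2 ⟨k + 1, m, 0, Or.inr (Or.inl ?_)⟩).symm⟩
    simp [axisPoint₁, e₃, h0, h1]
    ring
  · refine ⟨1, x 2, (proj_Γ₁_eq.2 ⟨k, m, 0, Or.inl ?_⟩).symm⟩
    simp [axisPoint₁, e₃, h0, h1, add_comm]

theorem exists_axis_Γ₁ (x : E) (hx : stab Γ₁ x ≠ ⊥) :
    ∃ i, proj Γ₁ x ∈ lineImage Γ₁ (axisPoint₁ i) e₃ := by
  obtain ⟨γ, hγ, hfix, hne⟩ := exists_fixing_of_stab_ne_bot hx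
  have hfix' := ext_coord.1 hfix
  obtain ⟨a, b, c, h | h | h | h⟩ := mem_Γ₁.1 hγ
  · exact (hne (eq_one_of_translation_of_fixed h hfix)).elim
  all_goals
    rw [h] at hfix'
    simp only [Matrix.cons_val] at hfix'
    obtain ⟨hx0, hx1, hx2⟩ := hfix'
  · exact proj_mem_lineImage_Γ₁ (p := a - b) (q := a + b) (by push_cast; linarith)
      (by push_cast; linarith)
  · exact proj_mem_lineImage_Γ₁ (p := a) (q := b) (by linarith) (by linarith)
  · exact proj_mem_lineImage_Γ₁ (p := a + b) (q := b - a) (by push_cast; linarith)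
      (by push_cast; linarith)

theorem exists_axis_Γ₂ (x : E) (hx : stab Γ₂ x ≠ ⊥) :
    ∃ i, proj Γ₂ x ∈ lineImage Γ₂ (axisPoint₂ i) (axisDir₂ i) := by
  obtain ⟨γ, hγ, hfix, hne⟩ := exists_fixing_of_stab_ne_bot hx
  have hfix' := ext_coord.1 hfix
  obtain ⟨a, b, c, h | h | h | h⟩ := mem_Γ₂.1 hγ
  · exact (hne (eq_one_of_translation_of_fixed h hfix)).elim
  all_goals
    rw [h] at hfix'
    simp only [Matrix.cons_val] at hfix'
    obtain ⟨hx0, hx1, hx2⟩ := hfix'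
  · exact (two_mul_cast_ne_one (-a) (by push_cast; linarith)).elim
  · -- an axis in direction `e₂`; if `a` is odd, `ρ 1` moves it to one with `a` even
    have h0 : x 0 = a := by linarith
    have h2 : x 2 = c / 2 := by linarith
    clear hx0 hx1 hx2 h
    rcases Int.even_or_odd' a with ⟨k, rfl | rfl⟩ <;>
      rcases Int.even_or_odd' c with ⟨m, rfl | rfl⟩ <;> push_cast at h0 h2
    · refine ⟨0, x 1, (proj_Γ₂_eq.2 ⟨k, 0, m, Or.inl ?_⟩).symm⟩
      simp [axisPoint₂, axisDir₂, e₂, h0, h2]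
    · refine ⟨1, x 1, (proj_Γ₂_eq.2 ⟨k, 0, m, Or.inl ?_⟩).symm⟩
      simp [axisPoint₂, axisDir₂, e₂, h0, h2]
      ring
    · refine ⟨0, -x 1, (proj_Γ₂_eq.2 ⟨k, 0, m, Or.inr (Or.inl ?_)⟩).symm⟩
      simp [axisPoint₂, axisDir₂, e₂, h0, h2]
      ring
    · refine ⟨1, -x 1, (proj_Γ₂_eq.2 ⟨k, 0, m + 1, Or.inr (Or.inl ?_)⟩).symm⟩
      simp [axisPoint₂, axisDir₂, e₂, h0, h2]
      constructor <;> ring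
  · -- an axis in direction `e₃`; if `a` is odd, `ρ 1` moves it to one with `a` even
    have h0 : x 0 = a + 1 / 2 := by linarith
    have h1 : x 1 = b := by linarith
    clear hx0 hx1 hx2 h
    rcases Int.even_or_odd' a with ⟨k, rfl | rfl⟩ <;>
      rcases Int.even_or_odd' b with ⟨m, rfl | rfl⟩ <;> push_cast at h0 h1
    · refine ⟨2, x 2, (proj_Γ₂_eq.2 ⟨k, m, 0, Or.inl ?_⟩).symm⟩
      simp [axisPoint₂, axisDir₂, e₃, h0, h1]
      ring
    · refine ⟨3, x 2, (proj_Γ₂_eq.2 ⟨k, m, 0, Or.inl ?_⟩).symm⟩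
      simp [axisPoint₂, axisDir₂, e₃, h0, h1]
      constructor <;> ring
    · refine ⟨2, -x 2, (proj_Γ₂_eq.2 ⟨k, m, 0, Or.inr (Or.inl ?_)⟩).symm⟩
      simp [axisPoint₂, axisDir₂, e₃, h0, h1]
      ring
    · refine ⟨3, -x 2, (proj_Γ₂_eq.2 ⟨k, m + 1, 0, Or.inr (Or.inl ?_)⟩).symm⟩
      simp [axisPoint₂, axisDir₂, e₃, h0, h1]
      constructor <;> ring

theorem disjoint_lineImage_Γ₁ (i j : Fin 3) (hij : i ≠ j) :
    Disjoint (lineImage Γ₁ (axisPoint₁ i) e₃) (lineImage Γ₁ (axisPoint₁ j) e₃) := by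
  rw [Set.disjoint_left]
  rintro _ ⟨s, rfl⟩ ⟨t, ht⟩
  obtain ⟨a, b, c, h⟩ := proj_Γ₁_eq.1 ht
  -- in each case, one of the first two coordinates violates a parity condition
  fin_cases i <;> fin_cases j <;> first | exact hij rfl | skip
  all_goals
    rcases h with ⟨h0, h1, -⟩ | ⟨h0, h1, -⟩ | ⟨h0, h1, -⟩ | ⟨h0, h1, -⟩ <;>
      simp [axisPoint₁, e₃] at h0 h1 <;>
      first
      | exact two_mul_cast_ne_one a (by linarith)
      | exact two_mul_cast_ne_one (-a) (by push_cast; linarith)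
      | exact two_mul_cast_ne_one b (by linarith)
      | exact two_mul_cast_ne_one (-b) (by push_cast; linarith)

theorem disjoint_lineImage_Γ₂ (i j : Fin 4) (hij : i ≠ j) :
    Disjoint (lineImage Γ₂ (axisPoint₂ i) (axisDir₂ i))
      (lineImage Γ₂ (axisPoint₂ j) (axisDir₂ j)) := by
  rw [Set.disjoint_left]
  rintro _ ⟨s, rfl⟩ ⟨t, ht⟩
  obtain ⟨a, b, c, h⟩ := proj_Γ₂_eq.1 ht
  -- in each case, one of the coordinates, multiplied by two, violates a parity condition
  fin_cases i <;> fin_cases j <;> first | exact hij rfl | skip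
  all_goals
    rcases h with ⟨h0, h1, h2⟩ | ⟨h0, h1, h2⟩ | ⟨h0, h1, h2⟩ | ⟨h0, h1, h2⟩ <;>
      simp [axisPoint₂, axisDir₂, e₂, e₃] at h0 h1 h2 <;>
      first
      | exact two_mul_cast_ne_one (2 * a) (by push_cast; linarith)
      | exact two_mul_cast_ne_one (-2 * a) (by push_cast; linarith)
      | exact two_mul_cast_ne_one (-2 * a - 1) (by push_cast; linarith)
      | exact two_mul_cast_ne_one (-a) (by push_cast; linarith)
      | exact two_mul_cast_ne_one a (by linarith)
      | exact two_mul_cast_ne_one b (by linarith)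
      | exact two_mul_cast_ne_one (-b) (by push_cast; linarith)
      | exact two_mul_cast_ne_one c (by linarith)
      | exact two_mul_cast_ne_one (-c) (by push_cast; linarith)

theorem norm_e₂ : ‖e₂‖ = 1 := by
  simp [e₂, EuclideanSpace.norm_eq, Fin.sum_univ_three]

theorem norm_e₃ : ‖e₃‖ = 1 := by
  simp [e₃, EuclideanSpace.norm_eq, Fin.sum_univ_three]

theorem isCircleOfLength_Γ₁ (i : Fin 3) : IsCircleOfLength Γ₁ (axisPoint₁ i) e₃ 1 := by
  refine ⟨one_pos, norm_e₃, fun s t => ?_⟩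
  rw [proj_Γ₁_eq]
  have h2 : ∀ r : ℝ, (axisPoint₁ i + r • e₃) 2 = r := by
    intro r
    fin_cases i <;> simp [axisPoint₁, e₃]
  rw [h2, h2]
  constructor
  · rintro ⟨a, b, c, h | h | h | h⟩ <;> exact ⟨c, by linarith [h.2.2]⟩
  · rintro ⟨n, hn⟩
    refine ⟨0, 0, n, Or.inl ⟨?_, ?_, by linarith⟩⟩ <;> simp [e₃]

theorem isCircleOfLength_Γ₂ (i : Fin 4) :
    IsCircleOfLength Γ₂ (axisPoint₂ i) (axisDir₂ i) ((![2, 2, 1, 1] : Fin 4 → ℝ) i) := by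
  refine ⟨by fin_cases i <;> simp, by fin_cases i <;> simp [axisDir₂, norm_e₂, norm_e₃],
    fun s t => ?_⟩
  rw [proj_Γ₂_eq]
  constructor
  · rintro ⟨a, b, c, h⟩
    fin_cases i
    all_goals
      rcases h with ⟨h0, h1, h2⟩ | ⟨h0, h1, h2⟩ | ⟨h0, h1, h2⟩ | ⟨h0, h1, h2⟩ <;>
        simp [axisPoint₂, axisDir₂, e₂, e₃] at h0 h1 h2 ⊢ <;>
        first
        | exact ⟨b, by linarith⟩
        | exact ⟨c, by linarith⟩
        | exact (two_mul_cast_ne_one a (by linarith)).elim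
        | exact (two_mul_cast_ne_one (2 * a) (by push_cast; linarith)).elim
        | exact (two_mul_cast_ne_one (-a) (by push_cast; linarith)).elim
  · rintro ⟨n, hn⟩
    fin_cases i
    · refine ⟨0, n, 0, Or.inl ?_⟩
      simp [axisPoint₂, axisDir₂, e₂] at hn ⊢
      linarith
    · refine ⟨0, n, 0, Or.inl ?_⟩
      simp [axisPoint₂, axisDir₂, e₂] at hn ⊢
      linarith
    · refine ⟨0, 0, n, Or.inl ?_⟩
      simp [axisPoint₂, axisDir₂, e₃] at hn ⊢
      linarith
    · refine ⟨0, 0, n, Or.inl ?_⟩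
      simp [axisPoint₂, axisDir₂, e₃] at hn ⊢
      linarith

end FlatOrbifold

end

noncomputable section

namespace FlatOrbifold

/-! ### Multiplicities of eigenvalues -/

theorem wave_injective : Function.Injective wave := by
  intro m n h
  have h0 : ∀ n : Fin 3 → ℤ, wave n 0 = 1 := fun n => by simp [wave]
  have hp : (2 * Real.pi * Complex.I : ℂ) ≠ 0 := Complex.two_pi_I_ne_zero
  funext i
  have h1 := partialD_wave m i 0
  rw [h, partialD_wave, h0, mul_one, mul_one] at h1
  have h2 := mul_left_cancel₀ hp h1
  have h3 : (period i : ℂ) ≠ 0 := by exact_mod_cast period_ne_zero i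
  have h4 := (div_left_inj' h3).1 h2
  exact_mod_cast h4.symm

/-- Plane waves are linearly independent, being distinct characters of `ℝ³`. -/
theorem linearIndependent_wave : LinearIndependent ℂ wave := by
  let F : (Fin 3 → ℤ) → (Multiplicative E →* ℂ) := fun n =>
    { toFun := fun x => wave n x.toAdd
      map_one' := by simp [wave]
      map_mul' := fun x y => wave_add n _ _ }
  have hF : Function.Injective F := by
    intro m n h
    exact wave_injective (congrArg (fun φ : Multiplicative E →* ℂ => (φ : Multiplicative E → ℂ)) h)
  exact (linearIndependent_monoidHom (Multiplicative E) ℂ).comp F hF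

theorem wave_periodic (n : Fin 3 → ℤ) {v : E} (hv : v ∈ lattice) (x : E) :
    wave n (x + v) = wave n x := by
  obtain ⟨a, b, c, rfl⟩ := hv
  rw [wave_add]
  have h : wave n !₂[2 * (a : ℝ), 2 * (b : ℝ), (c : ℝ)] = 1 := by
    rw [wave, Complex.exp_eq_one_iff]
    refine ⟨n 0 * a + n 1 * b + n 2 * c, ?_⟩
    simp only [phase_apply, Matrix.cons_val]
    push_cast
    ring
  rw [h, mul_one]

/-- The linear combination of plane waves with eigenvalue `l` with given coefficients. -/
def synth (l : ℂ) : (shell l → ℂ) →ₗ[ℂ] (E → ℂ) :=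
  Fintype.linearCombination ℂ fun n : shell l => wave n

theorem synth_eq (l : ℂ) (c : shell l → ℂ) : synth l c = ∑ n, c n • wave n := rfl

theorem synth_apply (l : ℂ) (c : shell l → ℂ) (x : E) :
    synth l c x = ∑ n, c n * wave n x := by
  simp [synth_eq, Finset.sum_apply]

theorem synth_single (l : ℂ) (n : shell l) (x : E) : synth l (Pi.single n 1) x = wave n x := by
  simp [synth, Fintype.linearCombination_apply_single]

theorem synth_injective (l : ℂ) : Function.Injective (synth l) :=
  (linearIndependent_wave.comp _ Subtype.val_injective).fintypeLinearCombination_injective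

/-- For the trivial group, `eigenspace` consists of all smooth eigenfunctions on `ℝ³`. -/
theorem synth_mem_eigenspace_bot (l : ℂ) (c : shell l → ℂ) : synth l c ∈ eigenspace ⊥ l := by
  rw [synth_eq]
  refine Submodule.sum_mem _ fun n _ => Submodule.smul_mem _ _ ⟨contDiff_wave n, ?_, fun x => ?_⟩
  · rintro γ hγ x
    rw [Subgroup.mem_bot.1 hγ]
    rfl
  · rw [laplacian_wave, neg_mul, neg_neg, n.2]

theorem synth_periodic (l : ℂ) (c : shell l → ℂ) {v : E} (hv : v ∈ lattice) (x : E) :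
    synth l c (x + v) = synth l c x := by
  simp only [synth_apply, wave_periodic _ hv]

theorem map_mem_shell {σ : (Fin 3 → ℤ) → (Fin 3 → ℤ)} (hσ : ∀ n, energy (σ n) = energy n) {l : ℂ}
    (n : shell l) : σ n ∈ shell l :=
  (congrArg Complex.ofReal (hσ n)).trans n.2

/-- The averaging operator `f ↦ ¼ ∑ⱼ f ∘ gⱼ` in terms of the coefficients of plane waves, where
composition with `gⱼ` maps the plane wave `n` to the multiple `s j n` of the plane wave `σ j n`. -/
def average (l : ℂ) (σ : Fin 4 → shell l → shell l) (s : Fin 4 → (Fin 3 → ℤ) → ℂ) :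
    (shell l → ℂ) →ₗ[ℂ] (shell l → ℂ) :=
  Fintype.linearCombination ℂ fun n : shell l =>
    (1 / 4 : ℂ) • ∑ j, s j n • (Pi.single (σ j n) 1 : shell l → ℂ)

theorem synth_average {l : ℂ} {g : Fin 4 → E ≃ᵢ E} {σ : Fin 4 → shell l → shell l}
    {s : Fin 4 → (Fin 3 → ℤ) → ℂ}
    (hw : ∀ j (n : shell l) x, wave n (g j x) = s j n * wave (σ j n) x)
    (c : shell l → ℂ) (x : E) :
    synth l (average l σ s c) x = (1 / 4) * ∑ j, synth l c (g j x) := by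
  simp only [average, Fintype.linearCombination_apply, map_sum, map_smul, Finset.sum_apply,
    Pi.smul_apply, smul_eq_mul, synth_single]
  simp only [synth_apply, hw]
  rw [Finset.sum_comm, Finset.mul_sum]
  refine Finset.sum_congr rfl fun n _ => ?_
  rw [Finset.mul_sum, Finset.mul_sum, Finset.mul_sum]
  exact Finset.sum_congr rfl fun j _ => by ring

theorem trace_average (l : ℂ) (σ : Fin 4 → shell l → shell l) (s : Fin 4 → (Fin 3 → ℤ) → ℂ) :
    LinearMap.trace ℂ _ (average l σ s) =
      ∑ n : shell l, (1 / 4) * ∑ j, if σ j n = n then s j n else 0 := by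
  rw [LinearMap.trace_eq_matrix_trace ℂ (Pi.basisFun ℂ (shell l)), Matrix.trace]
  refine Finset.sum_congr rfl fun n _ => ?_
  simp only [Matrix.diag_apply, LinearMap.toMatrix_apply, Pi.basisFun_apply, Pi.basisFun_repr,
    average, Fintype.linearCombination_apply_single, Pi.smul_apply, smul_eq_mul, Finset.sum_apply,
    one_mul]
  congr 1
  refine Finset.sum_congr rfl fun j _ => ?_
  rw [Pi.single_apply]
  simp [eq_comm]

/-- **Multiplicity formula.** The eigenspace of `Γ` is the range of the averaging projection on the
span of the plane waves, so its dimension is the trace of this projection. -/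
theorem finrank_eigenspace {Γ : Subgroup (E ≃ᵢ E)} {g : Fin 4 → E ≃ᵢ E}
    {m : Fin 4 → Fin 4 → Fin 4} (hsys : IsCosetSystem g m)
    (hΓ : (Γ : Set (E ≃ᵢ E)) = {γ | ∃ j : Fin 4, ∃ v ∈ lattice, γ = g j * transl v})
    {σ : Fin 4 → (Fin 3 → ℤ) → (Fin 3 → ℤ)} {s : Fin 4 → (Fin 3 → ℤ) → ℂ}
    (hσ : ∀ j n, energy (σ j n) = energy n)
    (hw : ∀ j n x, wave n (g j x) = s j n * wave (σ j n) x) (l : ℂ) :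
    FiniteDimensional ℂ (eigenspace Γ l) ∧ (Module.finrank ℂ (eigenspace Γ l) : ℂ) =
      ∑ n : shell l, (1 / 4) * ∑ j, if σ j n = n then s j n else 0 := by
  have hmem : ∀ j, ∀ v ∈ lattice, g j * transl v ∈ Γ := fun j v hv => by
    rw [← SetLike.mem_coe, hΓ]
    exact ⟨j, v, hv, rfl⟩
  have hg : ∀ j, g j ∈ Γ := fun j => by
    simpa [transl_zero] using hmem j 0 zero_mem_lattice
  have htr : ∀ v ∈ lattice, transl v ∈ Γ := fun v hv => by
    simpa [hsys.zero] using hmem 0 v hv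
  have hinv : ∀ f : E → ℂ, (∀ v ∈ lattice, ∀ x, f (x + v) = f x) → ∀ γ ∈ Γ, ∀ x,
      ∑ j, f (g j (γ x)) = ∑ j, f (g j x) := by
    intro f hf γ hγ x
    rw [← SetLike.mem_coe, hΓ] at hγ
    obtain ⟨k, v, hv, rfl⟩ := hγ
    rw [← (Equiv.ofBijective _ (hsys.bijective k)).sum_comp fun j => f (g j x)]
    refine Finset.sum_congr rfl fun j _ => ?_
    obtain ⟨w, hw, e⟩ := hsys.mul j k
    obtain ⟨u, hu, e'⟩ := hsys.mul_transl (m j k) _ (add_mem_lattice hv hw)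
    have e2 : g j * (g k * transl v) = transl u * g (m j k) := by
      rw [← e', ← mul_assoc, e, mul_assoc, transl_mul]
    calc f (g j ((g k * transl v) x)) = f ((g j * (g k * transl v)) x) := rfl
      _ = f (g (m j k) x + u) := by rw [e2]; rfl
      _ = f (g (m j k) x) := hf u hu _
  let σ' : Fin 4 → shell l → shell l := fun j n => ⟨σ j n, map_mem_shell (hσ j) n⟩
  have hw' : ∀ j (n : shell l) x, wave n (g j x) = s j n * wave (σ' j n) x :=
    fun j n x => hw j n x
  have hle : eigenspace Γ l ≤ LinearMap.range (synth l) := by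
    rintro f ⟨hf, hfΓ, hfl⟩
    obtain ⟨c, hc⟩ := exists_eq_sum_wave hf (fun v hv x => hfΓ _ (htr v hv) x) hfl
    exact ⟨c, by rw [hc, synth_eq]⟩
  have hmap : ((eigenspace Γ l).comap (synth l)).map (synth l) = eigenspace Γ l :=
    Submodule.map_comap_eq_of_le hle
  have hproj : LinearMap.IsProj ((eigenspace Γ l).comap (synth l)) (average l σ' s) := by
    constructor
    · intro c
      obtain ⟨h1, -, h3⟩ := synth_mem_eigenspace_bot l (average l σ' s c)
      refine ⟨h1, fun γ hγ x => ?_, h3⟩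
      rw [synth_average hw', synth_average hw',
        hinv _ (fun v hv x => synth_periodic l c hv x) γ hγ]
    · rintro c ⟨-, hc, -⟩
      refine synth_injective l (funext fun x => ?_)
      rw [synth_average hw', Finset.sum_congr rfl fun j _ => hc _ (hg j) x]
      simp
  let e := Submodule.equivMapOfInjective (synth l) (synth_injective l)
    ((eigenspace Γ l).comap (synth l))
  rw [hmap] at e
  refine ⟨Module.Finite.equiv e, ?_⟩
  rw [← e.finrank_eq, ← hproj.trace, trace_average]
  simp only [σ', Subtype.ext_iff]

/-- The frequency of `wave n ∘ τ ^ j`. -/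
def freqΓ₁ (j : Fin 4) (n : Fin 3 → ℤ) : Fin 3 → ℤ :=
  (![n, ![n 1, -n 0, n 2], ![-n 0, -n 1, n 2], ![-n 1, n 0, n 2]] : Fin 4 → Fin 3 → ℤ) j

/-- The frequency of `wave n ∘ ρ j`. -/
def freqΓ₂ (j : Fin 4) (n : Fin 3 → ℤ) : Fin 3 → ℤ :=
  (![n, ![n 0, -n 1, -n 2], ![-n 0, n 1, -n 2], ![-n 0, -n 1, n 2]] : Fin 4 → Fin 3 → ℤ) j

/-- The phase of `wave n ∘ ρ j`, caused by the translational part `±e₁` of `ρ 1` and `ρ 3`. -/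
def signΓ₂ (j : Fin 4) (n : Fin 3 → ℤ) : ℂ :=
  (![1, (-1) ^ n 0, 1, (-1) ^ n 0] : Fin 4 → ℂ) j

theorem wave_rot (j : Fin 4) (n : Fin 3 → ℤ) (x : E) :
    wave n (rot j x) = 1 * wave (freqΓ₁ j n) x := by
  rw [one_mul, wave, wave, phase_apply, phase_apply]
  congr 3
  fin_cases j <;> simp [rot, freqΓ₁, τ_apply, τ_sq_apply, τ_cube_apply] <;> ring

theorem exp_add_half (z : ℂ) (k : ℤ) :
    Complex.exp (z + Real.pi * Complex.I * k) = (-1) ^ k * Complex.exp z := by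
  rw [Complex.exp_add, mul_comm, mul_comm _ (k : ℂ), Complex.exp_int_mul, Complex.exp_pi_mul_I]

theorem wave_ρ (j : Fin 4) (n : Fin 3 → ℤ) (x : E) :
    wave n (ρ j x) = signΓ₂ j n * wave (freqΓ₂ j n) x := by
  rw [wave, wave, phase_apply, phase_apply]
  fin_cases j
  · simp [signΓ₂, freqΓ₂, ρ_zero, one_isometry_apply]
  · simp only [signΓ₂, freqΓ₂, Fin.mk_one, Matrix.cons_val, ← exp_add_half, ρ_one_apply]
    congr 1
    push_cast
    ring
  · simp only [signΓ₂, freqΓ₂, Fin.reduceFinMk, Matrix.cons_val, one_mul, ρ_two_apply]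
    congr 1
    push_cast
    ring
  · simp only [signΓ₂, freqΓ₂, Fin.reduceFinMk, Matrix.cons_val, ← exp_add_half, ρ_three_apply]
    congr 1
    push_cast
    ring

theorem energy_freqΓ₁ (j : Fin 4) (n : Fin 3 → ℤ) : energy (freqΓ₁ j n) = energy n := by
  fin_cases j <;> simp [energy, freqΓ₁, add_comm]

theorem energy_freqΓ₂ (j : Fin 4) (n : Fin 3 → ℤ) : energy (freqΓ₂ j n) = energy n := by
  fin_cases j <;> simp [energy, freqΓ₂]

theorem vec_eq_iff {a b c : ℤ} {n : Fin 3 → ℤ} : ![a, b, c] = n ↔ a = n 0 ∧ b = n 1 ∧ c = n 2 := by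
  constructor
  · rintro rfl
    exact ⟨rfl, rfl, rfl⟩
  · rintro ⟨rfl, rfl, rfl⟩
    funext i
    fin_cases i <;> rfl

theorem sum_character_Γ₁ (n : Fin 3 → ℤ) :
    (∑ j, if freqΓ₁ j n = n then (1 : ℂ) else 0) = 1 + 3 * if n 0 = 0 ∧ n 1 = 0 then 1 else 0 := by
  have h1 : freqΓ₁ 1 n = n ↔ n 0 = 0 ∧ n 1 = 0 := by
    rw [show freqΓ₁ 1 n = ![n 1, -n 0, n 2] from rfl, vec_eq_iff]; omega
  have h2 : freqΓ₁ 2 n = n ↔ n 0 = 0 ∧ n 1 = 0 := by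
    rw [show freqΓ₁ 2 n = ![-n 0, -n 1, n 2] from rfl, vec_eq_iff]; omega
  have h3 : freqΓ₁ 3 n = n ↔ n 0 = 0 ∧ n 1 = 0 := by
    rw [show freqΓ₁ 3 n = ![-n 1, n 0, n 2] from rfl, vec_eq_iff]; omega
  simp only [Fin.sum_univ_four, h1, h2, h3, show freqΓ₁ 0 n = n from rfl, if_true]
  ring

theorem sum_character_Γ₂ (n : Fin 3 → ℤ) :
    (∑ j, if freqΓ₂ j n = n then signΓ₂ j n else 0) =
      1 + (if n 1 = 0 ∧ n 2 = 0 then (-1) ^ n 0 else 0) + (if n 0 = 0 ∧ n 2 = 0 then 1 else 0) +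
        if n 0 = 0 ∧ n 1 = 0 then 1 else 0 := by
  have h1 : freqΓ₂ 1 n = n ↔ n 1 = 0 ∧ n 2 = 0 := by
    rw [show freqΓ₂ 1 n = ![n 0, -n 1, -n 2] from rfl, vec_eq_iff]; omega
  have h2 : freqΓ₂ 2 n = n ↔ n 0 = 0 ∧ n 2 = 0 := by
    rw [show freqΓ₂ 2 n = ![-n 0, n 1, -n 2] from rfl, vec_eq_iff]; omega
  have h3 : freqΓ₂ 3 n = n ↔ n 0 = 0 ∧ n 1 = 0 := by
    rw [show freqΓ₂ 3 n = ![-n 0, -n 1, n 2] from rfl, vec_eq_iff]; omega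
  simp only [Fin.sum_univ_four, h1, h2, h3, show freqΓ₂ 0 n = n from rfl, if_true]
  congr 1
  refine if_ctx_congr Iff.rfl (fun h => ?_) fun _ => rfl
  simp [signΓ₂, h.1]

/-- Frequencies along the second axis correspond to those along the first, on which the signs
`(-1) ^ n 0` cancel the odd ones; the even ones correspond to the frequencies along the third
axis. -/
theorem sum_axes (l : ℂ) :
    (∑ n : shell l, if n.1 1 = 0 ∧ n.1 2 = 0 then (-1 : ℂ) ^ n.1 0 else 0) +
      (∑ n : shell l, if n.1 0 = 0 ∧ n.1 2 = 0 then (1 : ℂ) else 0) =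
    2 * ∑ n : shell l, if n.1 0 = 0 ∧ n.1 1 = 0 then (1 : ℂ) else 0 := by
  let S := (shell l).toFinset
  have hS : ∀ n, n ∈ S ↔ (energy n : ℂ) = l := fun n => Set.mem_toFinset
  have hconv : ∀ F : (Fin 3 → ℤ) → ℂ, ∑ n : shell l, F n.1 = ∑ n ∈ S, F n :=
    fun F => Finset.sum_set_coe (shell l)
  rw [hconv fun n => if n 1 = 0 ∧ n 2 = 0 then (-1 : ℂ) ^ n 0 else 0,
    hconv fun n => if n 0 = 0 ∧ n 2 = 0 then (1 : ℂ) else 0,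
    hconv fun n => if n 0 = 0 ∧ n 1 = 0 then (1 : ℂ) else 0]
  have hswap : (∑ n ∈ S, if n 0 = 0 ∧ n 2 = 0 then (1 : ℂ) else 0) =
      ∑ n ∈ S, if n 1 = 0 ∧ n 2 = 0 then (1 : ℂ) else 0 := by
    have hinv : ∀ n : Fin 3 → ℤ, ![![n 1, n 0, n 2] 1, ![n 1, n 0, n 2] 0, ![n 1, n 0, n 2] 2] = n :=
      fun n => vec_eq_iff.2 ⟨rfl, rfl, rfl⟩
    have hm : ∀ n ∈ S, ![n 1, n 0, n 2] ∈ S := by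
      intro n hn
      rw [hS] at hn ⊢
      rw [← hn]
      simp [energy, add_comm]
    exact Finset.sum_nbij' (fun n => ![n 1, n 0, n 2]) (fun n => ![n 1, n 0, n 2]) hm hm
      (fun n _ => hinv n) (fun n _ => hinv n) fun n _ => rfl
  have heven : (∑ n ∈ S, if n 0 = 0 ∧ n 1 = 0 then (1 : ℂ) else 0) =
      ∑ n ∈ S, if (n 1 = 0 ∧ n 2 = 0) ∧ Even (n 0) then (1 : ℂ) else 0 := by
    rw [← Finset.sum_filter, ← Finset.sum_filter]
    refine Finset.sum_nbij' (fun n => ![2 * n 2, 0, 0]) (fun n => ![0, 0, n 0 / 2]) ?_ ?_ ?_ ?_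
      fun _ _ => rfl
    · intro n hn
      rw [Finset.mem_filter, hS] at hn ⊢
      refine ⟨?_, ⟨rfl, rfl⟩, even_two_mul _⟩
      rw [← hn.1]
      simp [energy, hn.2.1, hn.2.2]
      ring
    · intro n hn
      rw [Finset.mem_filter, hS] at hn ⊢
      obtain ⟨hn, ⟨h1, h2⟩, k, hk⟩ := hn
      refine ⟨?_, rfl, rfl⟩
      have hk' : n 0 / 2 = k := by omega
      rw [← hn]
      rw [energy, energy, h1, h2]
      simp only [Matrix.cons_val, hk']
      rw [hk]
      push_cast
      ring
    · intro n hn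
      rw [Finset.mem_filter] at hn
      rw [vec_eq_iff]
      simp only [Matrix.cons_val]
      omega
    · intro n hn
      rw [Finset.mem_filter] at hn
      obtain ⟨-, ⟨h1, h2⟩, k, hk⟩ := hn
      rw [vec_eq_iff]
      simp only [Matrix.cons_val]
      omega
  rw [hswap, heven, ← Finset.sum_add_distrib, Finset.mul_sum]
  refine Finset.sum_congr rfl fun n _ => ?_
  by_cases h : n 1 = 0 ∧ n 2 = 0
  · rcases Int.even_or_odd (n 0) with he | ho
    · simp [h, he, he.neg_one_zpow]
      norm_num
    · simp [h, ho.neg_one_zpow, Int.not_even_iff_odd.2 ho]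
  · simp [h]

theorem isospectral_Γ₁_Γ₂ : Isospectral Γ₁ Γ₂ := by
  intro l
  obtain ⟨hf1, hd1⟩ := finrank_eigenspace isCosetSystem_rot Γ₁_coe (s := fun _ _ => 1)
    energy_freqΓ₁ wave_rot l
  obtain ⟨hf2, hd2⟩ := finrank_eigenspace isCosetSystem_ρ Γ₂_coe energy_freqΓ₂ wave_ρ l
  refine ⟨hf1, hf2, ?_⟩
  have h : (Module.finrank ℂ (eigenspace Γ₁ l) : ℂ) = Module.finrank ℂ (eigenspace Γ₂ l) := by
    rw [hd1, hd2]
    simp only [sum_character_Γ₁, sum_character_Γ₂, ← Finset.mul_sum, Finset.sum_add_distrib]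
    linear_combination -(1 / 4 : ℂ) * sum_axes l
  exact_mod_cast h

end FlatOrbifold

end

theorem mainTheorem3 :
    -- the elements of the two groups
    ((FlatOrbifold.Γ₁ : Set (FlatOrbifold.E ≃ᵢ FlatOrbifold.E)) =
      {g | ∃ j : Fin 4, ∃ v ∈ FlatOrbifold.lattice,
        g = FlatOrbifold.τ ^ (j : ℕ) * FlatOrbifold.transl v}) ∧
    ((FlatOrbifold.Γ₂ : Set (FlatOrbifold.E ≃ᵢ FlatOrbifold.E)) =
      {g | ∃ j : Fin 4, ∃ v ∈ FlatOrbifold.lattice,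
        g = FlatOrbifold.ρ j * FlatOrbifold.transl v}) ∧
    -- the quotients are compact flat orbifolds, and the unit cube is a fundamental domain of both
    FlatOrbifold.IsCompactFlatOrbifold FlatOrbifold.Γ₁ ∧
    FlatOrbifold.IsCompactFlatOrbifold FlatOrbifold.Γ₂ ∧
    FlatOrbifold.IsFundDomain FlatOrbifold.Γ₁ FlatOrbifold.unitCube ∧
    FlatOrbifold.IsFundDomain FlatOrbifold.Γ₂ FlatOrbifold.unitCube ∧
    -- isospectrality on functions
    FlatOrbifold.Isospectral FlatOrbifold.Γ₁ FlatOrbifold.Γ₂ ∧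
    -- the maximal isotropy orders are four and two, hence differ; in the first orbifold the
    -- isotropy groups of maximal order are cyclic, in the second one all singular points have
    -- isotropy group of order two
    FlatOrbifold.IsMaxIsotropyOrder FlatOrbifold.Γ₁ 4 ∧
    (∀ x : FlatOrbifold.E, Nat.card (FlatOrbifold.stab FlatOrbifold.Γ₁ x) = 4 →
      FlatOrbifold.HasIsotropy FlatOrbifold.Γ₁ (FlatOrbifold.proj FlatOrbifold.Γ₁ x)
        (FlatOrbifold.Cyc 4)) ∧
    FlatOrbifold.IsMaxIsotropyOrder FlatOrbifold.Γ₂ 2 ∧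
    (∀ q ∈ FlatOrbifold.singularSet FlatOrbifold.Γ₂,
      FlatOrbifold.HasIsotropy FlatOrbifold.Γ₂ q (FlatOrbifold.Cyc 2)) ∧
    -- the singular set of the first orbifold: three disjoint circles of length one, two of them
    -- with isotropy group cyclic of order four and one of order two
    (FlatOrbifold.singularSet FlatOrbifold.Γ₁ = ⋃ i : Fin 3, FlatOrbifold.lineImage
      FlatOrbifold.Γ₁ (FlatOrbifold.axisPoint₁ i) FlatOrbifold.e₃) ∧
    (∀ i j : Fin 3, i ≠ j → Disjoint
      (FlatOrbifold.lineImage FlatOrbifold.Γ₁ (FlatOrbifold.axisPoint₁ i) FlatOrbifold.e₃)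
      (FlatOrbifold.lineImage FlatOrbifold.Γ₁ (FlatOrbifold.axisPoint₁ j) FlatOrbifold.e₃)) ∧
    (∀ i : Fin 3, FlatOrbifold.IsCircleOfLength FlatOrbifold.Γ₁
      (FlatOrbifold.axisPoint₁ i) FlatOrbifold.e₃ 1) ∧
    (∀ i : Fin 3, ∀ q ∈ FlatOrbifold.lineImage FlatOrbifold.Γ₁
      (FlatOrbifold.axisPoint₁ i) FlatOrbifold.e₃,
        FlatOrbifold.HasIsotropy FlatOrbifold.Γ₁ q
          (FlatOrbifold.Cyc ((![4, 4, 2] : Fin 3 → ℕ) i))) ∧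
    -- the singular set of the second orbifold: four disjoint circles, two of length two and two
    -- of length one
    (FlatOrbifold.singularSet FlatOrbifold.Γ₂ = ⋃ i : Fin 4, FlatOrbifold.lineImage
      FlatOrbifold.Γ₂ (FlatOrbifold.axisPoint₂ i) (FlatOrbifold.axisDir₂ i)) ∧
    (∀ i j : Fin 4, i ≠ j → Disjoint
      (FlatOrbifold.lineImage FlatOrbifold.Γ₂ (FlatOrbifold.axisPoint₂ i)
        (FlatOrbifold.axisDir₂ i))
      (FlatOrbifold.lineImage FlatOrbifold.Γ₂ (FlatOrbifold.axisPoint₂ j)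
        (FlatOrbifold.axisDir₂ j))) ∧
    (∀ i : Fin 4, FlatOrbifold.IsCircleOfLength FlatOrbifold.Γ₂
      (FlatOrbifold.axisPoint₂ i) (FlatOrbifold.axisDir₂ i)
      ((![2, 2, 1, 1] : Fin 4 → ℝ) i)) := by
  refine ⟨FlatOrbifold.Γ₁_coe, FlatOrbifold.Γ₂_coe,
    FlatOrbifold.isCompactFlatOrbifold_of_coset _ FlatOrbifold.Γ₁_coe
      FlatOrbifold.isFundDomain_Γ₁,
    FlatOrbifold.isCompactFlatOrbifold_of_coset _ FlatOrbifold.Γ₂_coe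
      FlatOrbifold.isFundDomain_Γ₂,
    FlatOrbifold.isFundDomain_Γ₁, FlatOrbifold.isFundDomain_Γ₂, FlatOrbifold.isospectral_Γ₁_Γ₂,
    FlatOrbifold.isMaxIsotropyOrder_of_lineImage (by decide) (by decide) (by decide) ⟨0, rfl⟩
      FlatOrbifold.hasIsotropy_lineImage_Γ₁ FlatOrbifold.exists_axis_Γ₁, ?_,
    FlatOrbifold.isMaxIsotropyOrder_of_lineImage (n := fun _ => 2) (by decide) (by decide)
      (by decide) ⟨0, rfl⟩
      FlatOrbifold.hasIsotropy_lineImage_Γ₂ FlatOrbifold.exists_axis_Γ₂, ?_,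
    FlatOrbifold.singularSet_eq_iUnion_lineImage (by decide)
      FlatOrbifold.hasIsotropy_lineImage_Γ₁ FlatOrbifold.exists_axis_Γ₁,
    FlatOrbifold.disjoint_lineImage_Γ₁, FlatOrbifold.isCircleOfLength_Γ₁,
    FlatOrbifold.hasIsotropy_lineImage_Γ₁,
    FlatOrbifold.singularSet_eq_iUnion_lineImage (n := fun _ => 2) (by decide)
      FlatOrbifold.hasIsotropy_lineImage_Γ₂ FlatOrbifold.exists_axis_Γ₂,
    FlatOrbifold.disjoint_lineImage_Γ₂, FlatOrbifold.isCircleOfLength_Γ₂⟩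
  · intro x hx
    have hne : FlatOrbifold.stab FlatOrbifold.Γ₁ x ≠ ⊥ := by
      intro h
      rw [h, Subgroup.card_bot] at hx
      omega
    obtain ⟨i, hi⟩ := FlatOrbifold.exists_axis_Γ₁ x hne
    have h := FlatOrbifold.hasIsotropy_lineImage_Γ₁ i _ hi
    rwa [← FlatOrbifold.card_stab h, hx] at h
  · rintro _ ⟨x, rfl, hx⟩
    obtain ⟨i, hi⟩ := FlatOrbifold.exists_axis_Γ₂ x hx
    exact FlatOrbifold.hasIsotropy_lineImage_Γ₂ i _ hi
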